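/- On $L^2(\mathbb R)$ let $P=-i\,d/ds$ (domain $H^1(\mathbb R)$) and let $e^{-Q}$ be multiplication by $e^{-s}$ (maximal domain); put $T=P$ and $R=e^{-Q}$. For real $\alpha,\beta$ let $e^{i(\alpha T+\beta R)}$ be the unitary operator generated by the essentially selfadjoint operator $\alpha T+\beta R$ on $D(T)\cap D(R)$. For $f\in L^1(\mathbb R^2)$ let \[ \hat f(\alpha,\beta)=\frac1{2\pi}\int_{\mathbb R^2} f(t,r)\,e^{-i(\alpha t+\beta r)}\,dt\,dr , \] and let $\widehat{L^1(\mathbb R^2)}=\{\hat g: g\in L^1(\mathbb R^2)\}$. For $f\in L^1(\mathbb R^2)\cap\widehat{L^1(\mathbb R^2)}$ define \[ f(T,R)=\frac1{2\pi}\int_{\mathbb R^2}\hat f(\alpha,\beta)\,e^{i(\alpha T+\beta R)}\,d\alpha\,d\beta , \] the integral being taken in the strong sense (it converges absolutely on each vector and defines a bounded operator). Lemma. Let $f\in L^1(\mathbb R^2)\cap\widehat{L^1(\mathbb R^2)}$. If \[ \int_{\{r>0\}}\frac1r\,|f(t,r)|^2\,dt\,dr<\infty , \] then $f(T,R)$ is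 a Hilbert--Schmidt operator, with Hilbert--Schmidt (Schatten) norm \[ \|f(T,R)\|_2=\left(\frac1{2\pi}\int_{\{r>0\}}\frac1r\,|f(t,r)|^2\,dt\,dr\right)^{1/2}. \] -/

import Mathlib

open MeasureTheory
open scoped ContDiff ENNReal InnerProductSpace

noncomputable section

namespace KappaMinkowski

/-! ## Hilbert-Schmidt operators -/

section HilbertSchmidt

variable {E : Type*} [NormedAddCommGroup E] [InnerProductSpace ℂ E] [CompleteSpace E]

/-- The squared Hilbert-Schmidt (Schatten 2-) norm `Tr (A* A) = ∑ᵢ ‖A eᵢ‖²` of a bounded operator,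
as an element of `[0, ∞]`, computed in one orthonormal basis `(eᵢ)` of the Hilbert space.
It does not depend on the basis: see `hsNormSq_eq`. -/
def hsNormSq (A : E →L[ℂ] E) : ℝ≥0∞ :=
  ∑' i : (Classical.choose (exists_hilbertBasis ℂ E) : Set E), ‖A (i : E)‖ₑ ^ 2

/-- `A` is a Hilbert-Schmidt operator. -/
def IsHilbertSchmidt (A : E →L[ℂ] E) : Prop := hsNormSq A < ⊤

/-- The Hilbert-Schmidt (Schatten 2-) norm of a Hilbert-Schmidt operator. -/
def hsNorm (A : E →L[ℂ] E) : ℝ := Real.sqrt (hsNormSq A).toReal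

theorem parseval_enorm {ι : Type*} (b : HilbertBasis ι ℂ E) (x : E) :
    ∑' i, ‖⟪b i, x⟫_ℂ‖ₑ ^ 2 = ‖x‖ₑ ^ 2 := by
  have h := b.hasSum_inner_mul_inner x x
  have h2 : HasSum (fun i => ‖⟪b i, x⟫_ℂ‖ ^ 2) (‖x‖ ^ 2) := by
    have h3 := (Complex.hasSum_re h)
    have e1 : (⟪x, x⟫_ℂ).re = ‖x‖ ^ 2 := by
      simpa using inner_self_eq_norm_sq (𝕜 := ℂ) x
    rw [e1] at h3
    refine h3.congr_fun (fun i => ?_) |> fun h => h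
    rw [← inner_conj_symm x (b i), ← Complex.normSq_eq_conj_mul_self, Complex.ofReal_re,
      Complex.normSq_eq_norm_sq]
  have h4 := ENNReal.ofReal_tsum_of_nonneg (fun i => by positivity) h2.summable
  rw [h2.tsum_eq] at h4
  simp only [ENNReal.ofReal_pow (norm_nonneg _), ofReal_norm] at h4
  exact h4.symm

theorem tsum_basis_eq_adjoint {ι κ : Type*} (b : HilbertBasis ι ℂ E) (c : HilbertBasis κ ℂ E)
    (A : E →L[ℂ] E) :
    ∑' i, ‖A (b i)‖ₑ ^ 2 = ∑' k, ‖(ContinuousLinearMap.adjoint A) (c k)‖ₑ ^ 2 := by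
  simp_rw [← parseval_enorm c (A _), ← parseval_enorm b ((ContinuousLinearMap.adjoint A) _)]
  rw [ENNReal.tsum_comm]
  refine tsum_congr fun k => tsum_congr fun i => ?_
  rw [ContinuousLinearMap.adjoint_inner_right, ← inner_conj_symm, RCLike.enorm_conj]

/-- The Hilbert-Schmidt norm may be computed in any orthonormal basis. -/
theorem hsNormSq_eq {ι : Type*} (b : HilbertBasis ι ℂ E) (A : E →L[ℂ] E) :
    hsNormSq A = ∑' i, ‖A (b i)‖ₑ ^ 2 := by
  obtain ⟨c, hc⟩ := Classical.choose_spec (exists_hilbertBasis ℂ E)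
  rw [tsum_basis_eq_adjoint b b A, ← tsum_basis_eq_adjoint c b A]
  simp only [hsNormSq, hc]

end HilbertSchmidt

/-! ## The exponential of an essentially selfadjoint operator -/

section Exponential

variable {E : Type*} [NormedAddCommGroup E] [InnerProductSpace ℂ E] [CompleteSpace E]

/-- `U` is a strongly continuous one-parameter unitary group whose generator extends `A`, that is
`d/dt U(t) ξ |_{t = 0} = i A ξ` for every `ξ` in the domain of `A`. -/
structure IsUnitaryGroupOf (A : E →ₗ.[ℂ] E) (U : ℝ → E →L[ℂ] E) : Prop where
  unitary : ∀ t, U t ∈ unitary (E →L[ℂ] E)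
  zero : U 0 = 1
  add : ∀ s t, U (s + t) = U s * U t
  continuous : ∀ ξ, Continuous fun t => U t ξ
  hasDerivAt : ∀ ξ : A.domain, HasDerivAt (fun t => U t (ξ : E)) (Complex.I • A ξ) 0

open Classical in
/-- The unitary operator `exp (i A)`, for `A` an essentially selfadjoint operator (identified with
its closure). By Stone's theorem, the selfadjoint extensions of a densely defined symmetric operator
`A` correspond to the strongly continuous one-parameter unitary groups whose generator extends `A`,
and `A` is essentially selfadjoint if and only if there is exactly one of them, `t ↦ exp (i t A)`.
The value is `0` if `A` fails this. -/
def expI (A : E →ₗ.[ℂ] E) : E →L[ℂ] E :=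
  if h : ∃! U : ℝ → E →L[ℂ] E, IsUnitaryGroupOf A U then h.choose 1 else 0

end Exponential

/-! ## The Schrödinger operators and the pair `T = P`, `R = exp (-Q)` -/

/-- The Hilbert space `L²(ℝ)`. -/
abbrev L2R : Type := Lp ℂ 2 (volume : Measure ℝ)

theorem integrable_test (ξ : L2R) {φ : ℝ → ℝ} (hφ : Continuous φ) (hc : HasCompactSupport φ) :
    Integrable fun s => (φ s : ℂ) * ξ s := by
  have h1 : LocallyIntegrable (ξ : ℝ → ℂ) volume := (Lp.memLp ξ).locallyIntegrable (by norm_num)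
  have h2 := h1.integrable_smul_left_of_hasCompactSupport hφ hc
  refine h2.congr (Filter.Eventually.of_forall fun s => ?_)
  simp

/-- The graph of `P = -i d/ds`: the pairs `(ξ, η)` in `L²(ℝ)` with `η = -i ξ'` in the sense of weak
derivatives. -/
def momentumGraph : Submodule ℂ (L2R × L2R) where
  carrier := {p | ∀ φ : ℝ → ℝ, ContDiff ℝ ∞ φ → HasCompactSupport φ →
    ∫ s, (φ s : ℂ) * p.2 s = Complex.I * ∫ s, ((deriv φ s : ℝ) : ℂ) * p.1 s}
  zero_mem' := by
    intro φ _ _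
    have h : ∀ ψ : ℝ → ℝ, ∫ s, (ψ s : ℂ) * (0 : L2R) s = 0 := by
      intro ψ
      refine integral_eq_zero_of_ae ?_
      filter_upwards [Lp.coeFn_zero ℂ 2 (volume : Measure ℝ)] with s hs
      simp [hs]
    simp only [Prod.fst_zero, Prod.snd_zero, h, mul_zero]
  add_mem' := by
    intro p q hp hq φ hφ hc
    have h : ∀ (a b : L2R) {ψ : ℝ → ℝ}, Continuous ψ → HasCompactSupport ψ →
        ∫ s, (ψ s : ℂ) * (a + b : L2R) s
          = (∫ s, (ψ s : ℂ) * a s) + ∫ s, (ψ s : ℂ) * b s := by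
      intro a b ψ hψ hcψ
      rw [← integral_add (integrable_test a hψ hcψ) (integrable_test b hψ hcψ)]
      refine integral_congr_ae ?_
      filter_upwards [Lp.coeFn_add a b] with s hs
      simp only [hs, Pi.add_apply, mul_add]
    rw [Prod.snd_add, Prod.fst_add, h _ _ hφ.continuous hc,
      h _ _ (hφ.continuous_deriv (by simp)) hc.deriv, hp φ hφ hc, hq φ hφ hc, mul_add]
  smul_mem' := by
    intro c p hp φ hφ hc
    have h : ∀ (a : L2R) (ψ : ℝ → ℝ),
        ∫ s, (ψ s : ℂ) * (c • a : L2R) s = c * ∫ s, (ψ s : ℂ) * a s := by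
      intro a ψ
      rw [← integral_const_mul]
      refine integral_congr_ae ?_
      filter_upwards [Lp.coeFn_smul c a] with s hs
      simp only [hs, Pi.smul_apply, smul_eq_mul]
      ring
    rw [Prod.smul_snd, Prod.smul_fst, h, h, hp φ hφ hc]
    ring

theorem momentumGraph_functional :
    ∀ p ∈ momentumGraph, p.1 = 0 → p.2 = 0 := by
  intro p hp h0
  have h1 : LocallyIntegrable (p.2 : ℝ → ℂ) volume :=
    (Lp.memLp p.2).locallyIntegrable (by norm_num)
  rw [Lp.eq_zero_iff_ae_eq_zero]
  refine ae_eq_zero_of_integral_contDiff_smul_eq_zero h1 fun φ hφ hc => ?_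
  have h2 := hp φ hφ hc
  have h3 : ∫ s, ((deriv φ s : ℝ) : ℂ) * p.1 s = 0 := by
    refine integral_eq_zero_of_ae ?_
    rw [h0]
    filter_upwards [Lp.coeFn_zero ℂ 2 (volume : Measure ℝ)] with s hs
    simp [hs]
  rw [h3, mul_zero] at h2
  simpa using h2

/-- The momentum operator `P = -i d/ds` on its usual domain, the Sobolev space `H¹(ℝ)`. -/
def momentum : L2R →ₗ.[ℂ] L2R := momentumGraph.toLinearPMap

theorem momentum_graph : momentum.graph = momentumGraph :=
  Submodule.toLinearPMap_graph_eq _ momentumGraph_functional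

/-- The graph of `exp (-Q)`: the pairs `(ξ, η)` in `L²(ℝ)` with `η(s) = exp (-s) ξ(s)`. -/
def radiusGraph : Submodule ℂ (L2R × L2R) where
  carrier := {p | ∀ᵐ s : ℝ, p.2 s = (Real.exp (-s) : ℂ) * p.1 s}
  zero_mem' := by
    change ∀ᵐ s : ℝ, (0 : L2R) s = (Real.exp (-s) : ℂ) * (0 : L2R) s
    filter_upwards [Lp.coeFn_zero ℂ 2 (volume : Measure ℝ)] with s hs
    simp [hs]
  add_mem' := by
    intro p q hp hq
    change ∀ᵐ s : ℝ, (p.2 + q.2 : L2R) s = (Real.exp (-s) : ℂ) * (p.1 + q.1 : L2R) s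
    filter_upwards [hp, hq, Lp.coeFn_add p.1 q.1, Lp.coeFn_add p.2 q.2] with s h1 h2 h3 h4
    simp only [h3, h4, Pi.add_apply, h1, h2, mul_add]
  smul_mem' := by
    intro c p hp
    change ∀ᵐ s : ℝ, (c • p.2 : L2R) s = (Real.exp (-s) : ℂ) * (c • p.1 : L2R) s
    filter_upwards [hp, Lp.coeFn_smul c p.1, Lp.coeFn_smul c p.2] with s h1 h3 h4
    simp only [h3, h4, Pi.smul_apply, h1, smul_eq_mul]
    ring

theorem radiusGraph_functional : ∀ p ∈ radiusGraph, p.1 = 0 → p.2 = 0 := by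
  intro p hp h0
  rw [Lp.eq_zero_iff_ae_eq_zero]
  have hp' : ∀ᵐ s : ℝ, p.2 s = (Real.exp (-s) : ℂ) * p.1 s := hp
  rw [h0] at hp'
  filter_upwards [hp', Lp.coeFn_zero ℂ 2 (volume : Measure ℝ)] with s h1 h2
  simp [h1]

/-- The operator `R = exp (-Q)` of multiplication by `exp (-s)` on its maximal domain. -/
def radius : L2R →ₗ.[ℂ] L2R := radiusGraph.toLinearPMap

theorem radius_graph : radius.graph = radiusGraph :=
  Submodule.toLinearPMap_graph_eq _ radiusGraph_functional

/-! ## Weyl operators and Weyl quantisation -/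

/-- The radial Weyl operator `exp (i (α T + β R))` with `T = P`, `R = exp (-Q)`; here `α T + β R` is
the sum of operators on `D(T) ∩ D(R)`. -/
def weyl (α β : ℝ) : L2R →L[ℂ] L2R := expI ((α : ℂ) • momentum + (β : ℂ) • radius)

/-- The Fourier transform `(2π)⁻¹ ∫ f(t,r) exp (-i (α t + β r)) dt dr` on `ℝ²`. -/
def fourier2 (f : ℝ × ℝ → ℂ) (q : ℝ × ℝ) : ℂ :=
  (2 * Real.pi : ℂ)⁻¹ * ∫ p : ℝ × ℝ, f p * Complex.exp (-Complex.I * (q.1 * p.1 + q.2 * p.2 : ℝ))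

/-- The class `L¹(ℝ²) ∩ (L¹(ℝ²))^` of symbols: integrable functions which coincide (almost
everywhere) with the Fourier transform of an integrable function. -/
def IsSymbol (f : ℝ × ℝ → ℂ) : Prop :=
  Integrable f ∧ ∃ g : ℝ × ℝ → ℂ, Integrable g ∧ f =ᵐ[volume] fourier2 g

/-- `A` is the operator `f(T,R) = (2π)⁻¹ ∫ f^(α,β) exp (i (α T + β R)) dα dβ`. The integral is taken
in the strong sense, i.e. as a convergent Bochner integral in `L²(ℝ)` after application to each
vector (the integrand is not measurable for the operator norm). -/
def IsQuantisation (f : ℝ × ℝ → ℂ) (A : L2R →L[ℂ] L2R) : Prop :=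
  ∀ ξ : L2R, Integrable (fun q : ℝ × ℝ => fourier2 f q • weyl q.1 q.2 ξ) ∧
    A ξ = (2 * Real.pi : ℂ)⁻¹ • ∫ q : ℝ × ℝ, fourier2 f q • weyl q.1 q.2 ξ

end KappaMinkowski

end

/-!
The Weyl operators are explicit. For real `α, β` put `κ(α) = ∫₀¹ exp (-α u) du > 0`; then
`exp (i (α T + β R)) ξ(s) = exp (i β κ(α) e⁻ˢ) ξ(s + α)` (`weyl_eq_phaseShift`). Indeed the operators
`phaseShift (α t) (β ∫₀ᵗ exp (-α u) du)` form a strongly continuous unitary group which leaves the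
test functions `C_c^∞(ℝ)` invariant and has derivative `i (α P + β e^{-Q})` on them. A dense invariant
subspace on which the derivative is known determines the group, and symmetry against test functions
shows that the generator extends `α P + β e^{-Q}` on all of `D(P) ∩ D(e^{-Q})` (`expI_eq_of_core`).

Inserting this formula, `f(T,R)` becomes an integral operator with kernel
`K(s, s + α) = (2π)⁻¹ H(α, κ(α) e⁻ˢ)`, where `H(α, r) = ∫ f^(α,β) exp (i β r) dβ`
(`weylIntegral_ae_eq`); here `f^` is integrable by Fourier inversion (`integrable_fourier2`). The
Hilbert-Schmidt norm is the `L²` norm of `K` (`hsNormSq_eq_lintegral_kernel`). For fixed `α` the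
substitution `r = κ(α) e⁻ˢ` turns `ds` into `dr / r` on `(0, ∞)`, so
`‖f(T,R)‖₂² = (2π)⁻² ∫ ∫_{r > 0} |H(α, r)|² dr / r dα` (`lintegral_enorm_sq_weylKernel`).
By Fourier inversion in the second variable, `H(α, r) = ∫ f(t,r) exp (-i α t) dt` almost everywhere,
and Plancherel's identity in the first variable replaces `∫ |H(α, r)|² dα` by `2π ∫ |f(t, r)|² dt`
(`lintegral_partialFourierInv_fourier2`).
-/

/-! ### Fourier inversion and the Plancherel identity -/

section FourierAE

open scoped FourierTransform

theorem lintegral_enorm_sq_Lp {X : Type*} [MeasurableSpace X] {μ : Measure X} (ξ : Lp ℂ 2 μ) :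
    ∫⁻ x, ‖ξ x‖ₑ ^ 2 ∂μ = ‖ξ‖ₑ ^ 2 := by
  rw [Lp.enorm_def, eLpNorm_eq_lintegral_rpow_enorm_toReal (by norm_num) (by norm_num),
    ← ENNReal.rpow_natCast, ← ENNReal.rpow_mul]
  simp

variable {V : Type*} [NormedAddCommGroup V] [InnerProductSpace ℝ V] [FiniteDimensional ℝ V]
  [MeasurableSpace V] [BorelSpace V]

theorem fourier_continuous_of_integrable {f : V → ℂ} (hf : Integrable f) : Continuous (𝓕 f) :=
  VectorFourier.fourierIntegral_continuous Real.continuous_fourierChar continuous_inner hf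

theorem integral_fourier_mul_eq_flip {f g : V → ℂ} (hf : Integrable f) (hg : Integrable g) :
    ∫ x, 𝓕 f x * g x = ∫ x, f x * 𝓕 g x := by
  have h := VectorFourier.integral_fourierIntegral_smul_eq_flip (μ := volume) (ν := volume)
    (L := innerₗ V) Real.continuous_fourierChar continuous_inner hf hg
  simp only [smul_eq_mul, flip_innerₗ] at h
  exact h

theorem ae_eq_of_forall_integral_schwartz_mul_eq {f g : V → ℂ} (hf : LocallyIntegrable f)
    (hg : LocallyIntegrable g)
    (h : ∀ φ : SchwartzMap V ℂ, ∫ x, φ x * f x = ∫ x, φ x * g x) : f =ᵐ[volume] g := by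
  refine ae_eq_of_integral_contDiff_smul_eq hf hg fun φ hφ hc => ?_
  have hg₁ : HasCompactSupport (Complex.ofRealCLM ∘ φ) := hc.comp_left rfl
  have hg₂ : ContDiff ℝ ∞ (Complex.ofRealCLM ∘ φ) := by fun_prop
  simpa using h (hg₁.toSchwartzMap hg₂)

/-- Fourier inversion almost everywhere, without a continuity assumption on `f`: both sides have
the same integral against every Schwartz function, since the Fourier transform is self-adjoint. -/
theorem fourierInv_fourier_ae_eq {f : V → ℂ} (hf : Integrable f) (hf' : Integrable (𝓕 f)) :
    𝓕⁻ (𝓕 f) =ᵐ[volume] f := by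
  have hc : Continuous (𝓕⁻ (𝓕 f)) := by
    rw [Real.fourierInv_eq_fourier_comp_neg]
    exact fourier_continuous_of_integrable hf'.comp_neg
  refine ae_eq_of_forall_integral_schwartz_mul_eq hc.locallyIntegrable hf.locallyIntegrable
    fun φ => ?_
  have h1 : ∫ x, φ x * 𝓕⁻ (𝓕 f) x = ∫ x, φ (-x) * 𝓕 (𝓕 f) x := by
    rw [← integral_neg_eq_self]
    simp only [Real.fourierInv_eq_fourier_neg, neg_neg]
  have hφ : Integrable fun x => φ (-x) := φ.integrable.comp_neg
  rw [h1, ← integral_fourier_mul_eq_flip hφ hf']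
  have hφ' : (𝓕 fun x => φ (-x)) = ⇑(𝓕⁻ φ : SchwartzMap V ℂ) := by
    rw [SchwartzMap.fourierInv_coe, Real.fourierInv_eq_fourier_comp_neg]
  have h2 : Integrable (𝓕 fun x => φ (-x)) := by
    rw [hφ']
    exact (𝓕⁻ φ : SchwartzMap V ℂ).integrable
  rw [← integral_fourier_mul_eq_flip h2 hf]
  congr 1 with x
  rw [hφ', ← SchwartzMap.fourier_coe, FourierTransform.fourier_fourierInv_eq]

/-- Plancherel's identity for the Fourier integral of a function in `L¹ ∩ L²`. The Fourier integral
agrees with the `L²` Fourier transform because both act in the same way on Schwartz functions. -/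
theorem lintegral_enorm_fourier_sq {f : V → ℂ} (hf : Integrable f) (hf2 : MemLp f 2) :
    ∫⁻ x, ‖𝓕 f x‖ₑ ^ 2 = ∫⁻ x, ‖f x‖ₑ ^ 2 := by
  set F : Lp ℂ 2 (volume : Measure V) := hf2.toLp f
  have key : (𝓕 F : Lp ℂ 2 (volume : Measure V)) =ᵐ[volume] 𝓕 f := by
    refine ae_eq_of_forall_integral_schwartz_mul_eq ((Lp.memLp _).locallyIntegrable (by norm_num))
      (fourier_continuous_of_integrable hf).locallyIntegrable fun φ => ?_
    have h := congrArg (fun T => T φ) (Lp.fourier_toTemperedDistribution_eq F)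
    simp only [TemperedDistribution.fourier_apply, Lp.toTemperedDistribution_apply,
      smul_eq_mul] at h
    rw [← h, ← integral_fourier_mul_eq_flip φ.integrable hf, SchwartzMap.fourier_coe]
    refine integral_congr_ae ?_
    filter_upwards [hf2.coeFn_toLp] with x hx
    rw [hx]
  have e1 : ∫⁻ x, ‖𝓕 f x‖ₑ ^ 2 = ∫⁻ x, ‖(𝓕 F : Lp ℂ 2 (volume : Measure V)) x‖ₑ ^ 2 :=
    lintegral_congr_ae (key.symm.fun_comp (fun z => ‖z‖ₑ ^ 2))
  have e2 : ∫⁻ x, ‖f x‖ₑ ^ 2 = ∫⁻ x, ‖F x‖ₑ ^ 2 :=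
    lintegral_congr_ae (hf2.coeFn_toLp.symm.fun_comp (fun z => ‖z‖ₑ ^ 2))
  rw [e1, e2, lintegral_enorm_sq_Lp, lintegral_enorm_sq_Lp, ← ofReal_norm, ← ofReal_norm,
    Lp.norm_fourier_eq]

end FourierAE

/-! ### Unitary groups and invariant cores -/

section ExpI

open KappaMinkowski

variable {E : Type*} [NormedAddCommGroup E] [InnerProductSpace ℂ E]

theorem hasDerivAt_group_orbit {U : ℝ → E →L[ℂ] E} (hadd : ∀ s t, U (s + t) = U s * U t)
    {ξ η : E} (h : HasDerivAt (fun t => U t ξ) η 0) (t : ℝ) :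
    HasDerivAt (fun u => U u ξ) (U t η) t := by
  have h1 : HasDerivAt (fun u => U (u - t) ξ) η t := by
    have := HasDerivAt.comp_sub_const t t (f := fun t => U t ξ) (f' := η) (by simpa using h)
    exact this
  have h2 := ((U t).restrictScalars ℝ).hasFDerivAt.comp_hasDerivAt t h1
  · refine (h2.congr_deriv (by simp)).congr_of_eventuallyEq (Filter.Eventually.of_forall ?_)
    intro u
    have := hadd t (u - t)
    simp only [add_sub_cancel] at this
    simp [this]

variable [CompleteSpace E]

theorem inner_group_neg {U : ℝ → E →L[ℂ] E} (hunit : ∀ t, U t ∈ unitary (E →L[ℂ] E))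
    (hzero : U 0 = 1) (hadd : ∀ s t, U (s + t) = U s * U t) (t : ℝ) (x y : E) :
    ⟪U (-t) x, y⟫_ℂ = ⟪x, U t y⟫_ℂ := by
  have h1 : U t (U (-t) x) = x := by
    have := hadd t (-t)
    rw [add_neg_cancel, hzero] at this
    exact (congrArg (fun T : E →L[ℂ] E => T x) this).symm
  have h2 := (ContinuousLinearMap.inner_map_map_iff_adjoint_comp_self (U t)).2
    (Unitary.star_mul_self_of_mem (hunit t)) (U (-t) x) y
  rw [h1] at h2
  exact h2.symm

variable {A : E →ₗ.[ℂ] E} {U : ℝ → E →L[ℂ] E} {D : Submodule ℂ E}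

/-- A strongly continuous unitary group `U` whose derivative at `0` is `i A` on a dense `U`-invariant
subspace `D` has a generator extending `A`, if `A` is symmetric against `D`. The elements of `D`
serve as test vectors: `⟪φ, U(t) ξ⟫ = ⟪U(-t) φ, ξ⟫` may be differentiated for every `ξ`, which gives
`U(t) ξ = ξ + ∫₀ᵗ U(u) (i A ξ) du` for `ξ` in the domain of `A`. -/
theorem isUnitaryGroupOf_of_core (hunit : ∀ t, U t ∈ unitary (E →L[ℂ] E)) (hzero : U 0 = 1)
    (hadd : ∀ s t, U (s + t) = U s * U t) (hcont : ∀ ξ, Continuous fun t => U t ξ)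
    (hdense : Dᗮ = ⊥) (hinv : ∀ t, ∀ φ ∈ D, U t φ ∈ D) (hDA : D ≤ A.domain)
    (hderiv : ∀ φ (hφ : φ ∈ D), HasDerivAt (fun t => U t φ) (Complex.I • A ⟨φ, hDA hφ⟩) 0)
    (hsymm : ∀ φ (hφ : φ ∈ D) (ξ : A.domain), ⟪A ⟨φ, hDA hφ⟩, (ξ : E)⟫_ℂ = ⟪φ, A ξ⟫_ℂ) :
    IsUnitaryGroupOf A U := by
  refine ⟨hunit, hzero, hadd, hcont, fun ξ => ?_⟩
  set w : ℝ → E := fun t => U t (Complex.I • A ξ) with hw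
  have hwc : Continuous w := hcont _
  have hW : ∀ t, HasDerivAt (fun t => ∫ u in (0 : ℝ)..t, w u) (w t) t := fun t =>
    intervalIntegral.integral_hasDerivAt_right (hwc.intervalIntegrable _ _)
      (hwc.stronglyMeasurableAtFilter _ _) hwc.continuousAt
  have key : ∀ t, U t ξ = ξ + ∫ u in (0 : ℝ)..t, w u := by
    intro t
    rw [← sub_eq_zero, ← Submodule.mem_bot ℂ, ← hdense, Submodule.mem_orthogonal]
    intro φ hφ
    have hg : ∀ t, HasDerivAt (fun t => ⟪U (-t) φ, (ξ : E)⟫_ℂ) ⟪φ, w t⟫_ℂ t := by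
      intro t
      have h1 := hasDerivAt_group_orbit hadd (hderiv _ (hinv (-t) φ hφ)) 0
      rw [hzero] at h1
      have h2 : HasDerivAt (fun u => U (-u) φ) (-(Complex.I • A ⟨_, hDA (hinv (-t) φ hφ)⟩)) t := by
        have h3 : HasDerivAt (fun u : ℝ => t - u) (-1) t := by
          simpa using (hasDerivAt_id t).const_sub t
        have h4 := HasDerivAt.scomp t (h := fun u : ℝ => t - u) (by simpa using h1) h3
        refine (h4.congr_deriv (by simp)).congr_of_eventuallyEq
          (Filter.Eventually.of_forall fun u => ?_)
        have := hadd (t - u) (-t)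
        rw [show t - u + -t = -u by ring] at this
        simp [this]
      have h5 := h2.inner ℂ (hasDerivAt_const t (ξ : E))
      refine h5.congr_deriv ?_
      rw [inner_zero_right, zero_add, inner_neg_left, inner_smul_left,
        hsymm _ (hinv (-t) φ hφ), hw,
        ← inner_group_neg hunit hzero hadd, inner_smul_right]
      simp
    have hk : ∀ t, HasDerivAt (fun t => ⟪φ, U t ξ - (ξ + ∫ u in (0 : ℝ)..t, w u)⟫_ℂ) 0 t := by
      intro t
      have h1 := (hg t).sub ((hasDerivAt_const t φ).inner ℂ ((hW t).const_add (ξ : E)))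
      refine (h1.congr_deriv (by simp)).congr_of_eventuallyEq
        (Filter.Eventually.of_forall fun u => ?_)
      simp only [Pi.sub_apply]
      rw [inner_group_neg hunit hzero hadd, inner_sub_right]
    have := is_const_of_deriv_eq_zero (fun t => (hk t).differentiableAt)
      (fun t => (hk t).deriv) t 0
    rw [this]
    simp [hzero]
  have h0 := (hW 0).const_add (ξ : E)
  refine (h0.congr_deriv (by simp [hw, hzero])).congr_of_eventuallyEq
    (Filter.Eventually.of_forall key)

/-- Two unitary groups whose generators extend `A` agree, if one of them leaves invariant a dense
subspace `D` of the domain of `A`: then `⟪V(t) φ, U(t) ψ⟫` is constant for `φ, ψ ∈ D`. -/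
theorem KappaMinkowski.IsUnitaryGroupOf.eq_of_core {V : ℝ → E →L[ℂ] E} (hU : IsUnitaryGroupOf A U)
    (hV : IsUnitaryGroupOf A V) (hdense : Dᗮ = ⊥) (hinv : ∀ t, ∀ φ ∈ D, U t φ ∈ D)
    (hDA : D ≤ A.domain) : V = U := by
  have hUD : ∀ φ (hφ : φ ∈ D), HasDerivAt (fun t => U t φ) (Complex.I • A ⟨φ, hDA hφ⟩) 0 :=
    fun φ hφ => hU.hasDerivAt ⟨φ, hDA hφ⟩
  have hVD : ∀ φ (hφ : φ ∈ D), HasDerivAt (fun t => V t φ) (Complex.I • A ⟨φ, hDA hφ⟩) 0 :=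
    fun φ hφ => hV.hasDerivAt ⟨φ, hDA hφ⟩
  have hconst : ∀ φ ∈ D, ∀ ψ ∈ D, ∀ t, ⟪V t φ, U t ψ⟫_ℂ = ⟪φ, ψ⟫_ℂ := by
    intro φ hφ ψ hψ t
    have hd : ∀ t, HasDerivAt (fun t => ⟪V t φ, U t ψ⟫_ℂ) 0 t := by
      intro t
      have hψt := hinv t ψ hψ
      have h1 := hasDerivAt_group_orbit hV.add (hVD φ hφ) t
      have h2 : HasDerivAt (fun t => U t ψ) (Complex.I • A ⟨U t ψ, hDA hψt⟩) t := by
        have h3 : HasDerivAt (fun u => U (u - t) (U t ψ))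
            (Complex.I • A ⟨U t ψ, hDA hψt⟩) t :=
          HasDerivAt.comp_sub_const t t (f := fun u => U u (U t ψ))
            (by simpa using hUD _ hψt)
        refine h3.congr_of_eventuallyEq (Filter.Eventually.of_forall fun u => ?_)
        have := hU.add (u - t) t
        rw [sub_add_cancel] at this
        simp [this]
      refine (h1.inner ℂ h2).congr_deriv ?_
      -- Since `⟪V(t) φ, V(h) U(t) ψ⟫ = ⟪V(t - h) φ, U(t) ψ⟫`, its derivative at `h = 0`
      -- identifies the two summands up to sign.
      have h4 : HasDerivAt (fun h => ⟪V t φ, V h (U t ψ)⟫_ℂ)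
          ⟪V t φ, Complex.I • A ⟨U t ψ, hDA hψt⟩⟫_ℂ 0 := by
        refine ((hasDerivAt_const (0 : ℝ) (V t φ)).inner ℂ (hVD _ hψt)).congr_deriv ?_
        rw [inner_zero_left, add_zero]
      have h5 : HasDerivAt (fun h => ⟪V t φ, V h (U t ψ)⟫_ℂ)
          (-⟪V t (Complex.I • A ⟨φ, hDA hφ⟩), U t ψ⟫_ℂ) 0 := by
        have h6 : HasDerivAt (fun h => V (t - h) φ) (-(V t (Complex.I • A ⟨φ, hDA hφ⟩))) 0 := by
          have := HasDerivAt.comp_const_sub t 0 (f := fun u => V u φ)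
            (f' := V t (Complex.I • A ⟨φ, hDA hφ⟩)) (by simpa using h1)
          simpa using this
        have h7 := h6.inner ℂ (hasDerivAt_const (0 : ℝ) (U t ψ))
        refine (h7.congr_deriv
          (by rw [inner_zero_right, zero_add, inner_neg_left])).congr_of_eventuallyEq
          (Filter.Eventually.of_forall fun h => ?_)
        have := hV.add (-h) t
        rw [show -h + t = t - h by ring] at this
        simp only [this, mul_apply_eq_comp]
        rw [inner_group_neg hV.unitary hV.zero hV.add]
      rw [h4.unique h5]
      ring
    have := is_const_of_deriv_eq_zero (fun t => (hd t).differentiableAt)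
      (fun t => (hd t).deriv) t 0
    simpa [hU.zero, hV.zero] using this
  have hD : D.topologicalClosure = ⊤ := (Submodule.topologicalClosure_eq_top_iff).2 hdense
  have hDd : Dense (D : Set E) := Submodule.dense_iff_topologicalClosure_eq_top.2 hD
  have hVinv : ∀ t x, V t (V (-t) x) = x := by
    intro t x
    have := hV.add t (-t)
    rw [add_neg_cancel, hV.zero] at this
    exact (congrArg (fun T : E →L[ℂ] E => T x) this).symm
  funext t
  refine ContinuousLinearMap.ext_on (s := (D : Set E)) (by rwa [Submodule.span_eq]) ?_
  intro ψ hψ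
  have h0 : V (-t) (U t ψ) - ψ = 0 := by
    rw [← Submodule.mem_bot ℂ, ← hdense, Submodule.mem_orthogonal]
    intro φ hφ
    rw [inner_sub_right, ← inner_group_neg hV.unitary hV.zero hV.add, neg_neg,
      hconst φ hφ ψ hψ t, sub_self]
  rw [← hVinv t (U t ψ), sub_eq_zero.1 h0]

theorem expI_eq_of_core (hunit : ∀ t, U t ∈ unitary (E →L[ℂ] E)) (hzero : U 0 = 1)
    (hadd : ∀ s t, U (s + t) = U s * U t) (hcont : ∀ ξ, Continuous fun t => U t ξ)
    (hdense : Dᗮ = ⊥) (hinv : ∀ t, ∀ φ ∈ D, U t φ ∈ D) (hDA : D ≤ A.domain)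
    (hderiv : ∀ φ (hφ : φ ∈ D), HasDerivAt (fun t => U t φ) (Complex.I • A ⟨φ, hDA hφ⟩) 0)
    (hsymm : ∀ φ (hφ : φ ∈ D) (ξ : A.domain), ⟪A ⟨φ, hDA hφ⟩, (ξ : E)⟫_ℂ = ⟪φ, A ξ⟫_ℂ) :
    expI A = U 1 := by
  have hU := isUnitaryGroupOf_of_core hunit hzero hadd hcont hdense hinv hDA hderiv hsymm
  have h : ∃! U : ℝ → E →L[ℂ] E, IsUnitaryGroupOf A U :=
    ⟨U, hU, fun V hV => hU.eq_of_core hV hdense hinv hDA⟩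
  rw [expI, dif_pos h]
  exact congrFun (h.unique h.choose_spec.1 hU) 1

end ExpI

namespace KappaMinkowski

/-! ### The operators of translation and multiplication by a radial phase -/

section PhaseShift

open Filter Topology

/-- On functions supported in a fixed compact set, the `L²` norm is controlled by the supremum
norm. -/
theorem exists_norm_le_mul_of_compact {K : Set ℝ} (hK : IsCompact K) :
    ∃ M : ℝ, 0 ≤ M ∧ ∀ (u : L2R) (C : ℝ),
      (∀ᵐ s, (s ∈ K → ‖u s‖ ≤ C) ∧ (s ∉ K → u s = 0)) → ‖u‖ ≤ C * M := by
  have hfin : (volume : Measure ℝ) K ≠ ⊤ := hK.measure_lt_top.ne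
  refine ⟨‖indicatorConstLp 2 hK.measurableSet hfin (1 : ℂ)‖, norm_nonneg _, fun u C h => ?_⟩
  refine Lp.norm_le_mul_norm_of_ae_le_mul ?_
  filter_upwards [h, indicatorConstLp_coeFn (p := 2) (hs := hK.measurableSet)
    (hμs := hfin) (c := (1 : ℂ))] with s hs h1
  rw [h1]
  by_cases hsK : s ∈ K
  · simpa [hsK] using hs.1 hsK
  · simp [hsK, hs.2 hsK]

/-- A jointly continuous family of functions with locally uniform compact support is continuous as
a family in `L²(ℝ)`. -/
theorem continuousAt_L2R_of_jointly_continuous {X : Type*} [TopologicalSpace X] {F : X → ℝ → ℂ}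
    (hF : Continuous fun p : X × ℝ => F p.1 p.2) {x₀ : X} {K : Set ℝ} (hK : IsCompact K)
    (hsupp : ∀ᶠ x in 𝓝 x₀, ∀ s ∉ K, F x s = 0) {u : X → L2R} (hu : ∀ x, u x =ᵐ[volume] F x) :
    ContinuousAt u x₀ := by
  obtain ⟨M, hM0, hM⟩ := exists_norm_le_mul_of_compact hK
  rw [ContinuousAt, tendsto_iff_norm_sub_tendsto_zero, Metric.tendsto_nhds]
  intro ε hε
  have hδ : 0 < ε / (M + 1) := by positivity
  have hunif : ∀ᶠ x in 𝓝 x₀, ∀ s ∈ K, ‖F x s - F x₀ s‖ < ε / (M + 1) := by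
    refine hK.eventually_forall_of_forall_eventually fun s _ => ?_
    have hc : Continuous fun p : X × ℝ => ‖F p.1 p.2 - F x₀ p.2‖ :=
      (hF.sub (hF.comp (continuous_const.prodMk continuous_snd))).norm
    have := hc.tendsto (x₀, s)
    simp only [sub_self, norm_zero] at this
    exact this.eventually (gt_mem_nhds hδ)
  filter_upwards [hunif, hsupp] with x hx hx0
  have hx00 := hsupp.self_of_nhds
  have h1 : ‖u x - u x₀‖ ≤ ε / (M + 1) * M := by
    refine hM _ _ ?_
    filter_upwards [Lp.coeFn_sub (u x) (u x₀), hu x, hu x₀] with s h1 h2 h3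
    rw [h1, Pi.sub_apply, h2, h3]
    exact ⟨fun hs => (hx s hs).le, fun hs => by rw [hx0 s hs, hx00 s hs, sub_zero]⟩
  rw [Real.dist_eq, sub_zero, abs_norm]
  refine h1.trans_lt ?_
  rw [div_mul_eq_mul_div, div_lt_iff₀ (by positivity)]
  nlinarith

/-- A family of functions with locally uniform compact support whose pointwise derivative in the
parameter is jointly continuous is differentiable as a family in `L²(ℝ)`. -/
theorem hasDerivAt_L2R_of_jointly_continuous {F F' : ℝ → ℝ → ℂ}
    (hF : ∀ t s, HasDerivAt (fun t => F t s) (F' t s) t)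
    (hF' : Continuous fun p : ℝ × ℝ => F' p.1 p.2) {K : Set ℝ} (hK : IsCompact K)
    (hsupp : ∀ᶠ t in 𝓝 (0 : ℝ), ∀ s ∉ K, F t s = 0) {u : ℝ → L2R} (hu : ∀ t, u t =ᵐ[volume] F t)
    {v : L2R} (hv : v =ᵐ[volume] F' 0) : HasDerivAt u v 0 := by
  obtain ⟨M, hM0, hM⟩ := exists_norm_le_mul_of_compact hK
  have hsupp' : ∀ s ∉ K, F' 0 s = 0 := by
    intro s hs
    have h1 : (fun t => F t s) =ᶠ[𝓝 0] fun _ => (0 : ℂ) := by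
      filter_upwards [hsupp] with t ht using ht s hs
    exact (hF 0 s).unique ((hasDerivAt_const (0 : ℝ) (0 : ℂ)).congr_of_eventuallyEq h1)
  rw [hasDerivAt_iff_isLittleO, Asymptotics.isLittleO_iff]
  intro ε hε
  have hδ : 0 < ε / (M + 1) := by positivity
  have hunif : ∀ᶠ t in 𝓝 (0 : ℝ), ∀ s ∈ K, ‖F' t s - F' 0 s‖ < ε / (M + 1) := by
    refine hK.eventually_forall_of_forall_eventually fun s _ => ?_
    have hc : Continuous fun p : ℝ × ℝ => ‖F' p.1 p.2 - F' 0 p.2‖ :=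
      (hF'.sub (hF'.comp (continuous_const.prodMk continuous_snd))).norm
    have := hc.tendsto (0, s)
    simp only [sub_self, norm_zero] at this
    exact this.eventually (gt_mem_nhds hδ)
  obtain ⟨δ, hδ0, hball⟩ := Metric.eventually_nhds_iff_ball.1 hunif
  filter_upwards [hsupp, Metric.ball_mem_nhds (0 : ℝ) hδ0] with t ht htδ
  have h0 := hsupp.self_of_nhds
  have hmv : ∀ s ∈ K, ‖F t s - F 0 s - (t : ℂ) * F' 0 s‖ ≤ ε / (M + 1) * |t| := by
    intro s hs
    have h1 : ∀ x ∈ Metric.ball (0 : ℝ) δ, HasDerivWithinAt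
        (fun t : ℝ => F t s - (t : ℂ) * F' 0 s) (F' x s - F' 0 s) (Metric.ball (0 : ℝ) δ) x := by
      intro x _
      have h2 : HasDerivAt (fun t : ℝ => (t : ℂ) * F' 0 s) (F' 0 s) x := by
        simpa using (Complex.ofRealCLM.hasDerivAt (x := x)).mul_const (F' 0 s)
      exact ((hF x s).sub h2).hasDerivWithinAt
    have h3 := (convex_ball (0 : ℝ) δ).norm_image_sub_le_of_norm_hasDerivWithin_le h1
      (fun x hx => (hball x hx s hs).le) (Metric.mem_ball_self hδ0) htδ
    simp only [Complex.ofReal_zero, zero_mul, sub_zero, Real.norm_eq_abs] at h3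
    rwa [sub_right_comm]
  have h1 : ‖u t - u 0 - (t - 0) • v‖ ≤ ε / (M + 1) * |t| * M := by
    refine hM _ _ ?_
    filter_upwards [Lp.coeFn_sub (u t - u 0) ((t - 0) • v), Lp.coeFn_sub (u t) (u 0), hu t, hu 0,
      hv, Lp.coeFn_smul (t - 0) v] with s h1 h2 h3 h4 h5 h6
    rw [h1, Pi.sub_apply, h2, Pi.sub_apply, h3, h4, h6, Pi.smul_apply, h5, sub_zero,
      Complex.real_smul]
    exact ⟨fun hs => hmv s hs, fun hs => by rw [ht s hs, h0 s hs, hsupp' s hs]; simp⟩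
  refine h1.trans ?_
  rw [Real.norm_eq_abs, sub_zero, mul_right_comm]
  refine mul_le_mul_of_nonneg_right ?_ (abs_nonneg t)
  rw [div_mul_eq_mul_div, div_le_iff₀ (by positivity)]
  nlinarith

/-- The phase `exp (i b e⁻ˢ)`. -/
noncomputable def radialPhase (b s : ℝ) : ℂ := Complex.exp ((b * Real.exp (-s) : ℝ) * Complex.I)

theorem norm_radialPhase (b s : ℝ) : ‖radialPhase b s‖ = 1 := Complex.norm_exp_ofReal_mul_I _

theorem continuous_radialPhase : Continuous fun p : ℝ × ℝ => radialPhase p.1 p.2 := by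
  unfold radialPhase
  fun_prop

theorem ae_comp_add_right {p : ℝ → Prop} (h : ∀ᵐ s, p s) (a : ℝ) : ∀ᵐ s, p (s + a) :=
  (measurePreserving_add_right volume a).quasiMeasurePreserving.ae h

theorem memLp_radialPhase_mul (a b : ℝ) (ξ : L2R) :
    MemLp (fun s => radialPhase b s * ξ (s + a)) 2 := by
  have h1 : MemLp (fun s => ξ (s + a)) 2 :=
    (Lp.memLp ξ).comp_measurePreserving (measurePreserving_add_right volume a)
  refine h1.of_le ((continuous_radialPhase.comp
    (continuous_const.prodMk continuous_id)).aestronglyMeasurable.mul h1.1) ?_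
  exact Filter.Eventually.of_forall fun s => by rw [norm_mul, norm_radialPhase, one_mul]

/-- The isometry `ξ ↦ exp (i b e⁻ˢ) ξ(s + a)` of `L²(ℝ)`. -/
noncomputable def phaseShift (a b : ℝ) : L2R →ₗᵢ[ℂ] L2R where
  toFun ξ := (memLp_radialPhase_mul a b ξ).toLp _
  map_add' ξ η := by
    rw [← MemLp.toLp_add]
    refine MemLp.toLp_congr _ _ ?_
    filter_upwards [ae_comp_add_right (Lp.coeFn_add ξ η) a] with s hs
    simp only [hs, Pi.add_apply, mul_add]
  map_smul' c ξ := by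
    rw [RingHom.id_apply, ← MemLp.toLp_const_smul]
    refine MemLp.toLp_congr _ _ ?_
    filter_upwards [ae_comp_add_right (Lp.coeFn_smul c ξ) a] with s hs
    simp only [hs, Pi.smul_apply, smul_eq_mul]
    ring
  norm_map' ξ := by
    change ‖(memLp_radialPhase_mul a b ξ).toLp _‖ = ‖ξ‖
    rw [Lp.norm_toLp, Lp.norm_def]
    congr 1
    rw [← eLpNorm_comp_measurePreserving (Lp.aestronglyMeasurable ξ)
      (measurePreserving_add_right volume a)]
    refine eLpNorm_congr_norm_ae (Filter.Eventually.of_forall fun s => ?_)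
    rw [norm_mul, norm_radialPhase, one_mul]
    rfl

theorem coeFn_phaseShift (a b : ℝ) (ξ : L2R) :
    phaseShift a b ξ =ᵐ[volume] fun s => radialPhase b s * ξ (s + a) :=
  (memLp_radialPhase_mul a b ξ).coeFn_toLp

theorem coeFn_phaseShift_of_ae_eq (a b : ℝ) {ξ : L2R} {φ : ℝ → ℂ} (h : ξ =ᵐ[volume] φ) :
    phaseShift a b ξ =ᵐ[volume] fun s => radialPhase b s * φ (s + a) := by
  filter_upwards [coeFn_phaseShift a b ξ, ae_comp_add_right h a] with s h1 h2
  rw [h1, h2]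

/-- The operators `phaseShift a b` compose according to the group law of the affine group of the
line. -/
theorem phaseShift_phaseShift (a b a' b' : ℝ) (ξ : L2R) :
    phaseShift a b (phaseShift a' b' ξ) = phaseShift (a + a') (b + Real.exp (-a) * b') ξ := by
  refine Lp.ext ?_
  filter_upwards [coeFn_phaseShift_of_ae_eq a b (coeFn_phaseShift a' b' ξ),
    coeFn_phaseShift (a + a') (b + Real.exp (-a) * b') ξ] with s h1 h2
  rw [h1, h2, ← mul_assoc, radialPhase, radialPhase, radialPhase, ← Complex.exp_add, add_assoc,
    ← add_mul, ← Complex.ofReal_add]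
  congr 4
  rw [show -(s + a) = -a + -s by ring, Real.exp_add]
  ring

theorem phaseShift_zero (ξ : L2R) : phaseShift 0 0 ξ = ξ := by
  refine Lp.ext ?_
  filter_upwards [coeFn_phaseShift 0 0 ξ] with s h1
  simp [h1, radialPhase]

theorem phaseShift_mem_unitary (a b : ℝ) :
    (phaseShift a b).toContinuousLinearMap ∈ unitary (L2R →L[ℂ] L2R) := by
  set T := (phaseShift a b).toContinuousLinearMap
  set S := (phaseShift (-a) (-(Real.exp a * b))).toContinuousLinearMap
  have h1 : star T * T = 1 := (ContinuousLinearMap.inner_map_map_iff_adjoint_comp_self T).1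
    (phaseShift a b).inner_map_map
  have h2 : T * S = 1 := by
    ext1 ξ
    change phaseShift a b (phaseShift (-a) (-(Real.exp a * b)) ξ) = ξ
    rw [phaseShift_phaseShift, add_neg_cancel]
    have : b + Real.exp (-a) * -(Real.exp a * b) = 0 := by
      rw [mul_neg, ← mul_assoc, ← Real.exp_add, neg_add_cancel, Real.exp_zero]
      ring
    rw [this, phaseShift_zero]
  have h3 : star T = S := by
    calc star T = star T * (T * S) := by rw [h2, mul_one]
      _ = S := by rw [← mul_assoc, h1, one_mul]
  exact Unitary.mem_iff.2 ⟨h1, by rw [h3, h2]⟩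

/-- The space `C_c^∞(ℝ)` of complex test functions, as a subspace of `L²(ℝ)`. -/
def testSpace : Submodule ℂ L2R where
  carrier := {ξ | ∃ φ : ℝ → ℂ, ContDiff ℝ ∞ φ ∧ HasCompactSupport φ ∧ ξ =ᵐ[volume] φ}
  zero_mem' := ⟨0, contDiff_const, HasCompactSupport.zero, Lp.coeFn_zero ℂ 2 volume⟩
  add_mem' := by
    rintro ξ η ⟨φ, hφ, hφc, h1⟩ ⟨ψ, hψ, hψc, h2⟩
    exact ⟨φ + ψ, hφ.add hψ, hφc.add hψc, (Lp.coeFn_add ξ η).trans (h1.add h2)⟩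
  smul_mem' := by
    rintro c ξ ⟨φ, hφ, hφc, h1⟩
    exact ⟨c • φ, contDiff_const.smul hφ, hφc.smul_left (f := fun _ => c),
      (Lp.coeFn_smul c ξ).trans (h1.const_smul c)⟩

theorem L2R_inner_def (ξ η : L2R) : ⟪ξ, η⟫_ℂ = ∫ s, starRingEnd ℂ (ξ s) * η s := by
  rw [L2.inner_def]
  refine integral_congr_ae (Filter.Eventually.of_forall fun s => ?_)
  simp only [RCLike.inner_apply, mul_comm]

/-- The test functions are dense in `L²(ℝ)`. -/
theorem testSpace_orthogonal : testSpaceᗮ = ⊥ := by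
  rw [eq_bot_iff]
  intro ξ hξ
  rw [Submodule.mem_orthogonal] at hξ
  rw [Submodule.mem_bot, Lp.eq_zero_iff_ae_eq_zero]
  refine ae_eq_zero_of_integral_contDiff_smul_eq_zero
    ((Lp.memLp ξ).locallyIntegrable (by norm_num)) fun φ hφ hc => ?_
  have hg₁ : HasCompactSupport (Complex.ofRealCLM ∘ φ) := hc.comp_left rfl
  have hg₂ : ContDiff ℝ ∞ (Complex.ofRealCLM ∘ φ) := by fun_prop
  have hm : MemLp (Complex.ofRealCLM ∘ φ) 2 volume := hg₂.continuous.memLp_of_hasCompactSupport hg₁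
  have h := hξ (hm.toLp _) ⟨_, hg₂, hg₁, hm.coeFn_toLp⟩
  rw [L2R_inner_def] at h
  rw [← h]
  refine integral_congr_ae ?_
  filter_upwards [hm.coeFn_toLp] with s hs
  simp [hs]

theorem phaseShift_mem_testSpace (a b : ℝ) {ξ : L2R} (hξ : ξ ∈ testSpace) :
    phaseShift a b ξ ∈ testSpace := by
  obtain ⟨φ, hφ, hc, h⟩ := hξ
  refine ⟨_, ?_, ?_, coeFn_phaseShift_of_ae_eq a b h⟩
  · have h1 : ContDiff ℝ ∞ fun s => radialPhase b s := by
      unfold radialPhase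
      have : ContDiff ℝ ∞ fun s : ℝ => ((b * Real.exp (-s) : ℝ) : ℂ) :=
        Complex.ofRealCLM.contDiff.comp (contDiff_const.mul (by fun_prop))
      fun_prop
    exact h1.mul (hφ.comp (by fun_prop))
  · exact (hc.comp_homeomorph (Homeomorph.addRight a)).mul_left

theorem exists_compact_translate_eq_zero {φ : ℝ → ℂ} (hc : HasCompactSupport φ) (a₀ : ℝ) :
    ∃ K : Set ℝ, IsCompact K ∧ ∀ᶠ a in 𝓝 a₀, ∀ s ∉ K, φ (s + a) = 0 := by
  refine ⟨(fun p : ℝ × ℝ => p.1 - p.2) '' (tsupport φ ×ˢ Metric.closedBall a₀ 1),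
    (hc.isCompact.prod (isCompact_closedBall a₀ 1)).image (by fun_prop), ?_⟩
  filter_upwards [Metric.closedBall_mem_nhds a₀ one_pos] with a ha s hs
  by_contra h
  exact hs ⟨(s + a, a), ⟨subset_tsupport _ h, ha⟩, by simp⟩

/-- Joint strong continuity: it is clear on test functions, and passes to the closure since the
operators are isometric. -/
theorem continuous_phaseShift (ξ : L2R) : Continuous fun p : ℝ × ℝ => phaseShift p.1 p.2 ξ := by
  have hdense : Dense (testSpace : Set L2R) := Submodule.dense_iff_topologicalClosure_eq_top.2
    (Submodule.topologicalClosure_eq_top_iff.2 testSpace_orthogonal)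
  have hcore : ∀ ξ ∈ testSpace, Continuous fun p : ℝ × ℝ => phaseShift p.1 p.2 ξ := by
    rintro ξ ⟨φ, hφ, hc, h⟩
    rw [continuous_iff_continuousAt]
    intro p₀
    obtain ⟨K, hK, hsupp⟩ := exists_compact_translate_eq_zero hc p₀.1
    refine continuousAt_L2R_of_jointly_continuous
      (u := fun p : ℝ × ℝ => phaseShift p.1 p.2 ξ)
      (F := fun p s => radialPhase p.2 s * φ (s + p.1)) ?_ hK ?_
      (fun p => coeFn_phaseShift_of_ae_eq p.1 p.2 h)
    · have := hφ.continuous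
      have h2 : Continuous fun p : (ℝ × ℝ) × ℝ => radialPhase p.1.2 p.2 :=
        continuous_radialPhase.comp (by fun_prop : Continuous fun p : (ℝ × ℝ) × ℝ => (p.1.2, p.2))
      fun_prop
    · filter_upwards [continuous_fst.continuousAt.eventually hsupp] with p hp s hs
      rw [hp s hs, mul_zero]
  rw [continuous_iff_continuousAt]
  intro p₀
  rw [Metric.continuousAt_iff']
  intro ε hε
  obtain ⟨η, hη, hd⟩ := Metric.dense_iff.1 hdense ξ (ε / 3) (by positivity)
  have h1 := Metric.continuousAt_iff'.1 ((hcore η hd).continuousAt (x := p₀)) (ε / 3)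
    (by positivity)
  rw [Metric.mem_ball] at hη
  filter_upwards [h1] with p hp
  calc dist (phaseShift p.1 p.2 ξ) (phaseShift p₀.1 p₀.2 ξ)
      ≤ dist (phaseShift p.1 p.2 ξ) (phaseShift p.1 p.2 η)
        + dist (phaseShift p.1 p.2 η) (phaseShift p₀.1 p₀.2 η)
        + dist (phaseShift p₀.1 p₀.2 η) (phaseShift p₀.1 p₀.2 ξ) := dist_triangle4 _ _ _ _
    _ < ε := by
      rw [LinearIsometry.dist_map, LinearIsometry.dist_map, dist_comm ξ η]
      linarith

/-! ### The Weyl operators -/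

/-- `∫₀ᵗ exp (-α u) du`, that is `(1 - exp (-α t)) / α` for `α ≠ 0` and `t` for `α = 0`. -/
noncomputable def expInt (α t : ℝ) : ℝ := ∫ u in (0 : ℝ)..t, Real.exp (-(α * u))

theorem expInt_zero (α : ℝ) : expInt α 0 = 0 := intervalIntegral.integral_same

theorem hasDerivAt_expInt (α t : ℝ) : HasDerivAt (expInt α) (Real.exp (-(α * t))) t := by
  have hc : Continuous fun u : ℝ => Real.exp (-(α * u)) := by fun_prop
  exact intervalIntegral.integral_hasDerivAt_right (hc.intervalIntegrable _ _)
    (hc.stronglyMeasurableAtFilter _ _) hc.continuousAt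

theorem continuous_expInt (α : ℝ) : Continuous (expInt α) :=
  continuous_iff_continuousAt.2 fun t => (hasDerivAt_expInt α t).continuousAt

/-- The cocycle identity which makes `t ↦ phaseShift (α t) (β expInt α t)` a one-parameter group. -/
theorem expInt_add (α s t : ℝ) :
    expInt α (s + t) = expInt α s + Real.exp (-(α * s)) * expInt α t := by
  have hc : Continuous fun u : ℝ => Real.exp (-(α * u)) := by fun_prop
  unfold expInt
  rw [← intervalIntegral.integral_add_adjacent_intervals (hc.intervalIntegrable 0 s)
    (hc.intervalIntegrable s (s + t)), ← intervalIntegral.integral_const_mul]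
  congr 1
  have := intervalIntegral.integral_comp_add_left (a := 0) (b := t)
    (fun u => Real.exp (-(α * u))) s
  rw [add_zero] at this
  rw [← this]
  refine intervalIntegral.integral_congr fun u _ => ?_
  rw [← Real.exp_add]
  ring_nf

theorem expInt_one_pos (α : ℝ) : 0 < expInt α 1 := by
  have hc : Continuous fun u : ℝ => Real.exp (-(α * u)) := by fun_prop
  exact intervalIntegral.intervalIntegral_pos_of_pos (hc.intervalIntegrable _ _)
    (fun u => Real.exp_pos _) one_pos

theorem continuous_expInt_one : Continuous fun α => expInt α 1 := by
  unfold expInt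
  exact intervalIntegral.continuous_parametric_intervalIntegral_of_continuous'
    (by fun_prop) _ _

theorem mem_momentum_domain_of_mem_graph {ξ η : L2R} (h : (ξ, η) ∈ momentumGraph) :
    ∃ hξ : ξ ∈ momentum.domain, momentum ⟨ξ, hξ⟩ = η := by
  rw [← momentum_graph, LinearPMap.mem_graph_iff] at h
  obtain ⟨y, hy1, hy2⟩ := h
  simp only at hy1 hy2
  subst hy1
  exact ⟨y.2, hy2⟩

theorem mem_radius_domain_of_mem_graph {ξ η : L2R} (h : (ξ, η) ∈ radiusGraph) :
    ∃ hξ : ξ ∈ radius.domain, radius ⟨ξ, hξ⟩ = η := by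
  rw [← radius_graph, LinearPMap.mem_graph_iff] at h
  obtain ⟨y, hy1, hy2⟩ := h
  simp only at hy1 hy2
  subst hy1
  exact ⟨y.2, hy2⟩

theorem momentum_mem_graph (ξ : momentum.domain) : ((ξ : L2R), momentum ξ) ∈ momentumGraph := by
  rw [← momentum_graph]
  exact momentum.mem_graph ξ

theorem radius_ae_eq (ξ : radius.domain) :
    ∀ᵐ s : ℝ, radius ξ s = (Real.exp (-s) : ℂ) * (ξ : L2R) s := by
  have := radius.mem_graph ξ
  rw [radius_graph] at this
  exact this

theorem memLp_of_test {φ : ℝ → ℂ} (hφ : Continuous φ) (hc : HasCompactSupport φ) :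
    MemLp φ 2 volume := hφ.memLp_of_hasCompactSupport hc

/-- On test functions `P` acts as `-i d/ds`. -/
theorem momentum_apply_test {ξ : L2R} {φ : ℝ → ℂ} (hφ : ContDiff ℝ ∞ φ)
    (hc : HasCompactSupport φ) (h : ξ =ᵐ[volume] φ) :
    ∃ hξ : ξ ∈ momentum.domain,
      momentum ⟨ξ, hξ⟩ =ᵐ[volume] fun s => -Complex.I * deriv φ s := by
  have hd : Continuous (deriv φ) := hφ.continuous_deriv (by simp)
  have hm : MemLp (fun s => -Complex.I * deriv φ s) 2 volume :=
    memLp_of_test (by fun_prop) hc.deriv.mul_left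
  have hg : (ξ, hm.toLp _) ∈ momentumGraph := by
    intro ψ hψ hψc
    have hψd : Continuous (deriv ψ) := hψ.continuous_deriv (by simp)
    have h1 : ∫ s, (ψ s : ℂ) * hm.toLp _ s = ∫ s, -Complex.I * ((ψ s : ℂ) * deriv φ s) := by
      refine integral_congr_ae ?_
      filter_upwards [hm.coeFn_toLp] with s hs
      rw [hs]; ring
    have h2 : ∫ s, ((deriv ψ s : ℝ) : ℂ) * ξ s = ∫ s, ((deriv ψ s : ℝ) : ℂ) * φ s := by
      refine integral_congr_ae ?_
      filter_upwards [h] with s hs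
      rw [hs]
    have hψC : HasCompactSupport fun s => (ψ s : ℂ) := hψc.comp_left Complex.ofReal_zero
    have hψC' : HasCompactSupport fun s => ((deriv ψ s : ℝ) : ℂ) :=
      hψc.deriv.comp_left Complex.ofReal_zero
    have hψ0 := hψ.continuous
    have hφ0 := hφ.continuous
    have hparts := integral_mul_deriv_eq_deriv_mul_of_integrable
      (u := fun s => (ψ s : ℂ)) (v := φ) (u' := fun s => ((deriv ψ s : ℝ) : ℂ)) (v' := deriv φ)
      (fun s _ => ((hψ.differentiable (by simp)) s).hasDerivAt.ofReal_comp)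
      (fun s _ => ((hφ.differentiable (by simp)) s).hasDerivAt)
      (Continuous.integrable_of_hasCompactSupport (by fun_prop) hψC.mul_right)
      (Continuous.integrable_of_hasCompactSupport (by fun_prop) hψC'.mul_right)
      (Continuous.integrable_of_hasCompactSupport (by fun_prop) hψC.mul_right)
    rw [h1, h2, integral_const_mul, hparts]
    ring
  obtain ⟨hξ, e⟩ := mem_momentum_domain_of_mem_graph hg
  exact ⟨hξ, by rw [e]; exact hm.coeFn_toLp⟩

theorem radius_apply_test {ξ : L2R} {φ : ℝ → ℂ} (hφ : ContDiff ℝ ∞ φ)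
    (hc : HasCompactSupport φ) (h : ξ =ᵐ[volume] φ) :
    ∃ hξ : ξ ∈ radius.domain,
      radius ⟨ξ, hξ⟩ =ᵐ[volume] fun s => (Real.exp (-s) : ℂ) * φ s := by
  have hφ0 := hφ.continuous
  have hm : MemLp (fun s => (Real.exp (-s) : ℂ) * φ s) 2 volume :=
    memLp_of_test (by fun_prop) hc.mul_left
  have hg : (ξ, hm.toLp _) ∈ radiusGraph := by
    change ∀ᵐ s : ℝ, hm.toLp _ s = (Real.exp (-s) : ℂ) * ξ s
    filter_upwards [hm.coeFn_toLp, h] with s h1 h2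
    rw [h1, h2]
  obtain ⟨hξ, e⟩ := mem_radius_domain_of_mem_graph hg
  exact ⟨hξ, by rw [e]; exact hm.coeFn_toLp⟩

theorem integrable_conj_test_mul (ξ : L2R) {φ : ℝ → ℂ} (hφ : Continuous φ)
    (hc : HasCompactSupport φ) : Integrable fun s => starRingEnd ℂ (φ s) * ξ s := by
  have h1 : LocallyIntegrable (ξ : ℝ → ℂ) volume := (Lp.memLp ξ).locallyIntegrable (by norm_num)
  have hcont : Continuous fun s => starRingEnd ℂ (φ s) := Complex.continuous_conj.comp hφ
  have hsupp : HasCompactSupport fun s => starRingEnd ℂ (φ s) :=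
    hc.comp_left (map_zero (starRingEnd ℂ))
  simpa only [smul_eq_mul] using h1.integrable_smul_left_of_hasCompactSupport hcont hsupp

/-- The defining relation of `P` in terms of weak derivatives, for complex test functions. -/
theorem integral_conj_mul_momentum (ξ : momentum.domain) {φ : ℝ → ℂ} (hφ : ContDiff ℝ ∞ φ)
    (hc : HasCompactSupport φ) :
    ∫ s, starRingEnd ℂ (φ s) * momentum ξ s
      = ∫ s, starRingEnd ℂ (-Complex.I * deriv φ s) * (ξ : L2R) s := by
  have hre : ContDiff ℝ ∞ fun s => (φ s).re := Complex.reCLM.contDiff.comp hφ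
  have him : ContDiff ℝ ∞ fun s => (φ s).im := Complex.imCLM.contDiff.comp hφ
  have hrec : HasCompactSupport fun s => (φ s).re := hc.comp_left Complex.zero_re
  have himc : HasCompactSupport fun s => (φ s).im := hc.comp_left Complex.zero_im
  have h1 := momentum_mem_graph ξ _ hre hrec
  have h2 := momentum_mem_graph ξ _ him himc
  simp only at h1 h2
  have hdre : ∀ s, deriv (fun s => (φ s).re) s = (deriv φ s).re := fun s =>
    (Complex.reCLM.hasFDerivAt.comp_hasDerivAt s
      ((hφ.differentiable (by simp)) s).hasDerivAt).deriv
  have hdim : ∀ s, deriv (fun s => (φ s).im) s = (deriv φ s).im := fun s =>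
    (Complex.imCLM.hasFDerivAt.comp_hasDerivAt s
      ((hφ.differentiable (by simp)) s).hasDerivAt).deriv
  have e1 : ∀ s, starRingEnd ℂ (φ s) * momentum ξ s
      = ((φ s).re : ℂ) * momentum ξ s - Complex.I * (((φ s).im : ℂ) * momentum ξ s) := by
    intro s
    conv_lhs => rw [← Complex.re_add_im (φ s)]
    simp only [map_add, map_mul, Complex.conj_ofReal, Complex.conj_I]
    ring
  have e2 : ∀ s, starRingEnd ℂ (-Complex.I * deriv φ s) * (ξ : L2R) s
      = Complex.I * (((deriv (fun s => (φ s).re) s : ℝ) : ℂ) * (ξ : L2R) s)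
        + (((deriv (fun s => (φ s).im) s : ℝ) : ℂ) * (ξ : L2R) s) := by
    intro s
    rw [hdre, hdim]
    conv_lhs => rw [← Complex.re_add_im (deriv φ s)]
    simp only [map_add, map_mul, map_neg, Complex.conj_ofReal, Complex.conj_I]
    linear_combination (-((deriv φ s).im : ℂ) * (ξ : L2R) s) * Complex.I_sq
  simp_rw [e1, e2]
  have hi : ∀ (η : L2R) {ψ : ℝ → ℝ}, ContDiff ℝ ∞ ψ → HasCompactSupport ψ →
      Integrable fun s => (ψ s : ℂ) * η s := fun η ψ h h' => integrable_test η h.continuous h'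
  rw [integral_sub (hi _ hre hrec) ((hi _ him himc).const_mul _), integral_const_mul, h1, h2,
    integral_add ((integrable_test _ (hre.continuous_deriv (by simp)) hrec.deriv).const_mul _)
      (integrable_test _ (him.continuous_deriv (by simp)) himc.deriv), integral_const_mul]
  linear_combination (-∫ s, ((deriv (fun s => (φ s).im) s : ℝ) : ℂ) * (ξ : L2R) s) * Complex.I_sq

theorem testSpace_le_domain (α β : ℝ) :
    testSpace ≤ ((α : ℂ) • momentum + (β : ℂ) • radius).domain := by
  rintro ξ ⟨φ, hφ, hc, h⟩
  exact ⟨(momentum_apply_test hφ hc h).1, (radius_apply_test hφ hc h).1⟩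

theorem weyl_generator_ae_eq (α β : ℝ) (ξ : ((α : ℂ) • momentum + (β : ℂ) • radius).domain) :
    ((α : ℂ) • momentum + (β : ℂ) • radius) ξ =ᵐ[volume]
      fun s => α * momentum ⟨ξ, ξ.2.1⟩ s + β * radius ⟨ξ, ξ.2.2⟩ s := by
  have e : ((α : ℂ) • momentum + (β : ℂ) • radius) ξ
      = (α : ℂ) • momentum ⟨ξ, ξ.2.1⟩ + (β : ℂ) • radius ⟨ξ, ξ.2.2⟩ := rfl
  rw [e]
  filter_upwards [Lp.coeFn_add ((α : ℂ) • momentum ⟨ξ, ξ.2.1⟩) ((β : ℂ) • radius ⟨ξ, ξ.2.2⟩),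
    Lp.coeFn_smul (α : ℂ) (momentum ⟨ξ, ξ.2.1⟩), Lp.coeFn_smul (β : ℂ) (radius ⟨ξ, ξ.2.2⟩)]
    with s h1 h2 h3
  rw [h1, Pi.add_apply, h2, h3]
  rfl

/-- The operator `α P + β exp (-Q)` on `D(P) ∩ D(exp (-Q))` is symmetric against test functions;
for `P` this is the definition of its domain by weak derivatives. -/
theorem weyl_generator_symm (α β : ℝ) (ξ : L2R) (hξ : ξ ∈ testSpace)
    (η : ((α : ℂ) • momentum + (β : ℂ) • radius).domain) :
    ⟪((α : ℂ) • momentum + (β : ℂ) • radius) ⟨ξ, testSpace_le_domain α β hξ⟩, (η : L2R)⟫_ℂ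
      = ⟪ξ, ((α : ℂ) • momentum + (β : ℂ) • radius) η⟫_ℂ := by
  obtain ⟨φ, hφ, hc, h⟩ := hξ
  have hP := (momentum_apply_test hφ hc h).2
  have hR := (radius_apply_test hφ hc h).2
  have hφ0 := hφ.continuous
  have hd : Continuous (deriv φ) := hφ.continuous_deriv (by simp)
  rw [L2R_inner_def, L2R_inner_def]
  have e1 : ∫ s, starRingEnd ℂ (ξ s) * ((α : ℂ) • momentum + (β : ℂ) • radius) η s
      = ∫ s, (α * (starRingEnd ℂ (φ s) * momentum ⟨η, η.2.1⟩ s)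
        + β * (starRingEnd ℂ ((Real.exp (-s) : ℂ) * φ s) * (η : L2R) s)) := by
    refine integral_congr_ae ?_
    filter_upwards [weyl_generator_ae_eq α β η, h, radius_ae_eq ⟨η, η.2.2⟩] with s h1 h2 h3
    rw [h1, h2, h3, map_mul, Complex.conj_ofReal]
    ring
  have e2 : ∫ s, starRingEnd ℂ (((α : ℂ) • momentum + (β : ℂ) • radius)
        ⟨ξ, testSpace_le_domain α β ⟨φ, hφ, hc, h⟩⟩ s) * (η : L2R) s
      = ∫ s, (α * (starRingEnd ℂ (-Complex.I * deriv φ s) * (η : L2R) s)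
        + β * (starRingEnd ℂ ((Real.exp (-s) : ℂ) * φ s) * (η : L2R) s)) := by
    refine integral_congr_ae ?_
    filter_upwards [weyl_generator_ae_eq α β ⟨ξ, testSpace_le_domain α β ⟨φ, hφ, hc, h⟩⟩,
      hP, hR] with s h1 h2 h3
    rw [h1, h2, h3]
    simp only [map_add, map_mul, Complex.conj_ofReal]
    ring
  have i1 := integrable_conj_test_mul (momentum ⟨η, η.2.1⟩) hφ0 hc
  have i2 : Integrable fun s => starRingEnd ℂ ((Real.exp (-s) : ℂ) * φ s) * (η : L2R) s :=
    integrable_conj_test_mul (η : L2R) (by fun_prop) hc.mul_left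
  have i3 : Integrable fun s => starRingEnd ℂ (-Complex.I * deriv φ s) * (η : L2R) s :=
    integrable_conj_test_mul (η : L2R) (by fun_prop) hc.deriv.mul_left
  rw [e1, e2, integral_add (i1.const_mul _) (i2.const_mul _),
    integral_add (i3.const_mul _) (i2.const_mul _), integral_const_mul, integral_const_mul,
    integral_const_mul, integral_conj_mul_momentum ⟨η, η.2.1⟩ hφ hc]

/-- The group `t ↦ phaseShift (α t) (β expInt α t)` has derivative `i (α P + β exp (-Q))` on test
functions. -/
theorem hasDerivAt_phaseShift_test (α β : ℝ) (ξ : L2R) (hξ : ξ ∈ testSpace) :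
    HasDerivAt (fun t => phaseShift (α * t) (β * expInt α t) ξ)
      (Complex.I • ((α : ℂ) • momentum + (β : ℂ) • radius)
        ⟨ξ, testSpace_le_domain α β hξ⟩) 0 := by
  obtain ⟨φ, hφ, hc, h⟩ := hξ
  have hP := (momentum_apply_test hφ hc h).2
  have hR := (radius_apply_test hφ hc h).2
  have hφ0 := hφ.continuous
  have hd : Continuous (deriv φ) := hφ.continuous_deriv (by simp)
  obtain ⟨K, hK, hsupp⟩ := exists_compact_translate_eq_zero hc 0
  have hcE := continuous_expInt α
  refine hasDerivAt_L2R_of_jointly_continuous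
    (F := fun t s => radialPhase (β * expInt α t) s * φ (s + α * t))
    (F' := fun t s => radialPhase (β * expInt α t) s *
        ((β * Real.exp (-(α * t)) * Real.exp (-s) : ℝ) * Complex.I) * φ (s + α * t)
      + radialPhase (β * expInt α t) s * (α * deriv φ (s + α * t))) ?_ ?_ hK ?_
    (fun t => coeFn_phaseShift_of_ae_eq _ _ h) ?_
  · intro t s
    have h1 : HasDerivAt (fun t => β * expInt α t * Real.exp (-s))
        (β * Real.exp (-(α * t)) * Real.exp (-s)) t :=
      ((hasDerivAt_expInt α t).const_mul β).mul_const _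
    have h2 : HasDerivAt (fun t => radialPhase (β * expInt α t) s) _ t :=
      (h1.ofReal_comp.mul_const Complex.I).cexp
    have h3 : HasDerivAt (fun t => s + α * t) α t := by
      simpa using ((hasDerivAt_id t).const_mul α).const_add s
    have h4 : HasDerivAt (fun t => φ (s + α * t)) (α * deriv φ (s + α * t)) t := by
      simpa [Function.comp_def] using ((hφ.differentiable (by simp)) _).hasDerivAt.scomp t h3
    exact h2.mul h4
  · have h2 : Continuous fun p : ℝ × ℝ => radialPhase (β * expInt α p.1) p.2 :=
      continuous_radialPhase.comp
        (by fun_prop : Continuous fun p : ℝ × ℝ => (β * expInt α p.1, p.2))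
    fun_prop
  · have h1 : Tendsto (fun t : ℝ => α * t) (𝓝 0) (𝓝 0) := by
      have : Continuous fun t : ℝ => α * t := by fun_prop
      simpa using this.tendsto 0
    filter_upwards [h1.eventually hsupp] with t ht s hs
    rw [ht s hs, mul_zero]
  · filter_upwards [Lp.coeFn_smul Complex.I (((α : ℂ) • momentum + (β : ℂ) • radius)
        ⟨ξ, testSpace_le_domain α β ⟨φ, hφ, hc, h⟩⟩),
      weyl_generator_ae_eq α β ⟨ξ, testSpace_le_domain α β ⟨φ, hφ, hc, h⟩⟩, hP, hR]
      with s h1 h2 h3 h4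
    rw [h1, Pi.smul_apply, h2, h3, h4, expInt_zero]
    simp only [mul_zero, neg_zero, Real.exp_zero, mul_one, add_zero, smul_eq_mul, radialPhase,
      zero_mul, Complex.ofReal_zero, Complex.exp_zero, one_mul, Complex.ofReal_mul]
    linear_combination (-(α : ℂ) * deriv φ s) * Complex.I_sq

/-- The Weyl operator is given explicitly by `exp (i (α T + β R)) ξ(s) = exp (i β κ e⁻ˢ) ξ(s + α)`
with `κ = ∫₀¹ exp (-α u) du`. -/
theorem weyl_eq_phaseShift (α β : ℝ) :
    weyl α β = (phaseShift α (β * expInt α 1)).toContinuousLinearMap := by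
  have h := expI_eq_of_core (A := (α : ℂ) • momentum + (β : ℂ) • radius)
    (U := fun t => (phaseShift (α * t) (β * expInt α t)).toContinuousLinearMap)
    (D := testSpace) (fun t => phaseShift_mem_unitary _ _) ?_ ?_ ?_ testSpace_orthogonal
    (fun t φ hφ => phaseShift_mem_testSpace _ _ hφ) (testSpace_le_domain α β)
    (fun φ hφ => hasDerivAt_phaseShift_test α β φ hφ)
    (fun φ hφ ξ => weyl_generator_symm α β φ hφ ξ)
  · rw [weyl, h, mul_one]
  · ext1 ξ
    change phaseShift (α * 0) (β * expInt α 0) ξ = ξ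
    rw [expInt_zero, mul_zero, mul_zero, phaseShift_zero]
  · intro s t
    ext1 ξ
    change phaseShift (α * (s + t)) (β * expInt α (s + t)) ξ
      = phaseShift (α * s) (β * expInt α s) (phaseShift (α * t) (β * expInt α t) ξ)
    rw [phaseShift_phaseShift, expInt_add]
    congr 2 <;> ring
  · intro ξ
    have hcE := continuous_expInt α
    exact (continuous_phaseShift ξ).comp
      (by fun_prop : Continuous fun t => (α * t, β * expInt α t))

end PhaseShift

/-! ### Fourier transforms on the line and on the plane -/

open scoped FourierTransform Real

section OneDimensional

/-- Passage from Mathlib's normalisation `exp (-2πi a t)` of the Fourier kernel to `exp (-i a t)`. -/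
theorem fourier_div_two_pi (k : ℝ → ℂ) (a : ℝ) :
    𝓕 k (a / (2 * π)) = ∫ t, k t * Complex.exp (-Complex.I * (a * t : ℝ)) := by
  rw [Real.fourier_real_eq_integral_exp_smul]
  refine integral_congr_ae (Filter.Eventually.of_forall fun t => ?_)
  simp only [smul_eq_mul]
  rw [mul_comm]
  congr 2
  have : -2 * π * t * (a / (2 * π)) = -(a * t) := by field_simp
  rw [this]
  push_cast
  ring

theorem lintegral_comp_div_two_pi (F : ℝ → ℝ≥0∞) :
    ∫⁻ a, F (a / (2 * π)) = ENNReal.ofReal (2 * π) * ∫⁻ a, F a := by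
  have hpos : (0 : ℝ) < 2 * π := by positivity
  have h := MeasureTheory.lintegral_image_eq_lintegral_abs_deriv_mul (s := Set.univ)
    MeasurableSet.univ (f := fun a : ℝ => 2 * π * a) (f' := fun _ => 2 * π)
    (fun x _ => by simpa using (hasDerivAt_id x).const_mul (2 * π))
    (fun x _ y _ hxy => mul_left_cancel₀ hpos.ne' hxy) (fun a => F (a / (2 * π)))
  have himg : (fun a : ℝ => 2 * π * a) '' Set.univ = Set.univ := by
    rw [Set.image_univ, Set.range_eq_univ]
    exact fun y => ⟨y / (2 * π), by field_simp⟩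
  rw [himg, Measure.restrict_univ] at h
  rw [h, abs_of_pos hpos, lintegral_const_mul' _ _ ENNReal.ofReal_ne_top]
  congr 2 with a
  congr 1
  field_simp

theorem lintegral_enorm_sq_fourier_integral {k : ℝ → ℂ} (hk : Integrable k) (hk2 : MemLp k 2) :
    ∫⁻ a : ℝ, ‖∫ t, k t * Complex.exp (-Complex.I * (a * t : ℝ))‖ₑ ^ 2
      = ENNReal.ofReal (2 * π) * ∫⁻ t, ‖k t‖ₑ ^ 2 := by
  rw [← lintegral_enorm_fourier_sq hk hk2,
    ← lintegral_comp_div_two_pi fun a => ‖𝓕 k a‖ₑ ^ 2]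
  simp_rw [fourier_div_two_pi]

/-- Fourier inversion almost everywhere on the line, for the Fourier kernel `exp (-i b r)`. -/
theorem ae_eq_inverse_fourier_integral {h g : ℝ → ℂ} (hh : Integrable h) (hg : Integrable g)
    (hgh : ∀ b, g b = (2 * π : ℂ)⁻¹ * ∫ r, h r * Complex.exp (-Complex.I * (b * r : ℝ))) :
    ∀ᵐ r, ∫ b, g b * Complex.exp (Complex.I * (b * r : ℝ)) = h r := by
  have hpi : (2 * π : ℂ) ≠ 0 := by simp [Real.pi_ne_zero]
  have hpos : (0 : ℝ) < 2 * π := by positivity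
  have e : 𝓕 h = fun b => (2 * π : ℂ) * g (b * (2 * π)) := by
    funext b
    rw [hgh, ← fourier_div_two_pi, mul_inv_cancel_left₀ hpi, mul_div_cancel_right₀ _ hpos.ne']
  have hF : Integrable (𝓕 h) := by
    rw [e]
    exact (hg.comp_mul_right' hpos.ne').const_mul _
  filter_upwards [fourierInv_fourier_ae_eq hh hF] with r hr
  rw [← hr, Real.fourierInv_eq_fourier_neg, Real.fourier_real_eq_integral_exp_smul, e]
  have h1 := Measure.integral_comp_mul_right
    (fun b => g b * Complex.exp (Complex.I * (b * r : ℝ))) (2 * π)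
  rw [abs_of_pos (inv_pos.2 hpos), Complex.real_smul] at h1
  have h2 : ∫ b, g b * Complex.exp (Complex.I * (b * r : ℝ))
      = (2 * π : ℂ) * ∫ b, g (b * (2 * π)) * Complex.exp (Complex.I * (b * (2 * π) * r : ℝ)) := by
    rw [h1]
    push_cast
    rw [mul_inv_cancel_left₀ hpi]
  rw [h2, ← integral_const_mul]
  refine integral_congr_ae (Filter.Eventually.of_forall fun b => ?_)
  simp only [smul_eq_mul]
  rw [show (((-2 * π * b * -r : ℝ) : ℂ) * Complex.I) = Complex.I * (b * (2 * π) * r : ℝ) by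
    push_cast; ring]
  ring

end OneDimensional

section TwoDimensional

/-- The Fourier transform on `ℝ²` in terms of that of the real inner product space `ℂ`; the product
`ℝ × ℝ` carries the supremum norm and is not an inner product space. -/
theorem fourier2_eq_fourier (f : ℝ × ℝ → ℂ) (w : ℂ) :
    fourier2 f (Complex.measurableEquivRealProd w)
      = (2 * π : ℂ)⁻¹ * 𝓕 (f ∘ Complex.measurableEquivRealProd) ((2 * π : ℝ)⁻¹ • w) := by
  unfold fourier2
  congr 1
  rw [← Complex.volume_preserving_equiv_real_prod.integral_comp
    Complex.measurableEquivRealProd.measurableEmbedding, Real.fourier_eq']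
  refine integral_congr_ae (Filter.Eventually.of_forall fun z => ?_)
  simp only [smul_eq_mul, Function.comp_apply]
  rw [mul_comm]
  congr 2
  rw [real_inner_smul_right, Complex.inner]
  simp only [Complex.measurableEquivRealProd_apply, Complex.mul_re, Complex.conj_re,
    Complex.conj_im]
  have : -2 * π * ((2 * π)⁻¹ * (w.re * z.re - w.im * -z.im))
      = -(w.re * z.re + w.im * z.im) := by field_simp; ring
  rw [this]
  push_cast
  ring

theorem continuous_fourier2 {f : ℝ × ℝ → ℂ} (hf : Integrable f) : Continuous (fourier2 f) := by
  have hF : Integrable (f ∘ Complex.measurableEquivRealProd) :=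
    Complex.volume_preserving_equiv_real_prod.integrable_comp_of_integrable hf
  have h := fourier_continuous_of_integrable hF
  have e : fourier2 f = fun q => (2 * π : ℂ)⁻¹ *
      𝓕 (f ∘ Complex.measurableEquivRealProd) ((2 * π : ℝ)⁻¹ • Complex.equivRealProdCLM.symm q) := by
    funext q
    rw [← fourier2_eq_fourier]
    rfl
  rw [e]
  fun_prop

/-- If `f` is almost everywhere the Fourier transform of an integrable `g`, then by Fourier inversion
the Fourier transform of `f` is almost everywhere `g(-·)`, hence integrable. -/
theorem integrable_fourier2 {f : ℝ × ℝ → ℂ} (hf : IsSymbol f) : Integrable (fourier2 f) := by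
  obtain ⟨hf1, g, hg, hfg⟩ := hf
  set e := Complex.measurableEquivRealProd with he
  have hmp : MeasurePreserving e := Complex.volume_preserving_equiv_real_prod
  have hG : Integrable (g ∘ e) := hmp.integrable_comp_of_integrable hg
  have hpos : (0 : ℝ) < 2 * π := by positivity
  have hpi : (2 * π : ℂ) ≠ 0 := by simp [Real.pi_ne_zero]
  have hF : f ∘ e =ᵐ[volume] fun w => (2 * π : ℂ)⁻¹ * 𝓕 (g ∘ e) ((2 * π : ℝ)⁻¹ • w) := by
    filter_upwards [hmp.quasiMeasurePreserving.ae hfg] with w hw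
    rw [Function.comp_apply, hw, fourier2_eq_fourier]
  have hF1 : Integrable (f ∘ e) := hmp.integrable_comp_of_integrable hf1
  have hG' : Integrable (𝓕 (g ∘ e)) := by
    have h1 := ((hF1.congr hF).const_mul (2 * π : ℂ)).comp_smul hpos.ne'
    refine h1.congr (Filter.Eventually.of_forall fun w => ?_)
    simp only
    rw [mul_inv_cancel_left₀ hpi, inv_smul_smul₀ hpos.ne']
  have hGG : Integrable (𝓕 (𝓕 (g ∘ e))) := by
    have h1 : Integrable (𝓕⁻ (𝓕 (g ∘ e))) :=
      hG.congr (fourierInv_fourier_ae_eq hG hG').symm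
    refine h1.comp_neg.congr (Filter.Eventually.of_forall fun w => ?_)
    simp only
    rw [Real.fourierInv_eq_fourier_neg, neg_neg]
  rw [← hmp.integrable_comp_emb e.measurableEmbedding]
  -- The substitution `v ↦ 2π v` cancels all factors `2π`.
  refine hGG.congr (Filter.Eventually.of_forall fun w => ?_)
  rw [Function.comp_apply, fourier2_eq_fourier, Real.fourier_congr_ae hF, Real.fourier_eq,
    Real.fourier_eq]
  have h1 := Measure.integral_comp_smul (volume : Measure ℂ)
    (fun v => (Real.fourierChar (-⟪v, w⟫_ℝ)) • 𝓕 (g ∘ e) v) (2 * π)⁻¹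
  have h2 : ∀ v : ℂ, (Real.fourierChar (-⟪v, (2 * π : ℝ)⁻¹ • w⟫_ℝ)) •
      ((2 * π : ℂ)⁻¹ * 𝓕 (g ∘ e) ((2 * π : ℝ)⁻¹ • v))
      = (2 * π : ℂ)⁻¹ * ((Real.fourierChar (-⟪(2 * π : ℝ)⁻¹ • v, w⟫_ℝ)) •
        𝓕 (g ∘ e) ((2 * π : ℝ)⁻¹ • v)) := by
    intro v
    rw [real_inner_smul_right, real_inner_smul_left, mul_smul_comm]
  simp_rw [h2]
  rw [integral_const_mul, h1, Complex.finrank_real_complex, abs_of_pos (by positivity),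
    Complex.real_smul]
  push_cast
  field_simp

end TwoDimensional

/-- The Fourier transform `∫ f(t,r) exp (-i α t) dt` in the first variable. -/
noncomputable def partialFourier (f : ℝ × ℝ → ℂ) (a r : ℝ) : ℂ :=
  ∫ t, f (t, r) * Complex.exp (-Complex.I * (a * t : ℝ))

theorem integrable_mul_cexp {X : Type*} [MeasurableSpace X] {μ : Measure X} {f : X → ℂ}
    (hf : Integrable f μ) {θ : X → ℝ} (hθ : Measurable θ) :
    Integrable (fun x => f x * Complex.exp (-Complex.I * (θ x : ℝ))) μ := by
  refine hf.mul_bdd (c := 1) (by fun_prop) (Filter.Eventually.of_forall fun x => ?_)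
  rw [neg_mul, ← mul_neg, mul_comm, ← Complex.ofReal_neg, Complex.norm_exp_ofReal_mul_I]

theorem integrable_partialFourier {f : ℝ × ℝ → ℂ} (hf : Integrable f) (a : ℝ) :
    Integrable (partialFourier f a) := by
  have h := integrable_mul_cexp hf (θ := fun p => a * p.1) (by fun_prop)
  exact h.integral_prod_right

theorem fourier2_eq_integral_partialFourier {f : ℝ × ℝ → ℂ} (hf : Integrable f) (a b : ℝ) :
    fourier2 f (a, b)
      = (2 * π : ℂ)⁻¹ * ∫ r, partialFourier f a r * Complex.exp (-Complex.I * (b * r : ℝ)) := by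
  unfold fourier2
  congr 1
  have h := integrable_mul_cexp hf (θ := fun p => a * p.1 + b * p.2) (by fun_prop)
  refine (integral_prod_symm _ h).trans ?_
  refine integral_congr_ae (Filter.Eventually.of_forall fun r => ?_)
  simp only [partialFourier]
  rw [← integral_mul_const]
  refine integral_congr_ae (Filter.Eventually.of_forall fun t => ?_)
  simp only
  rw [mul_assoc, ← Complex.exp_add]
  congr 2
  push_cast
  ring

/-- The inverse Fourier transform `∫ g(α,β) exp (i β r) dβ` in the second variable. -/
noncomputable def partialFourierInv (g : ℝ × ℝ → ℂ) (a r : ℝ) : ℂ :=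
  ∫ b, g (a, b) * Complex.exp (Complex.I * (b * r : ℝ))

/-- Undoing the second variable of `fourier2 f` leaves the Fourier transform of `f` in its first
variable. -/
theorem partialFourierInv_fourier2_ae_eq {f : ℝ × ℝ → ℂ} (hf : Integrable f)
    (hf' : Integrable (fourier2 f)) :
    ∀ᵐ a : ℝ, ∀ᵐ r : ℝ, partialFourierInv (fourier2 f) a r = partialFourier f a r := by
  filter_upwards [hf'.prod_right_ae] with a ha
  exact ae_eq_inverse_fourier_integral (integrable_partialFourier hf a) ha
    (fourier2_eq_integral_partialFourier hf a)

theorem stronglyMeasurable_partialFourierInv {g : ℝ × ℝ → ℂ} (hg : Continuous g) :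
    StronglyMeasurable fun p : ℝ × ℝ => partialFourierInv g p.1 p.2 := by
  have h : Continuous fun x : (ℝ × ℝ) × ℝ =>
      g (x.1.1, x.2) * Complex.exp (Complex.I * (x.2 * x.1.2 : ℝ)) := by fun_prop
  exact h.stronglyMeasurable.integral_prod_right'

theorem aestronglyMeasurable_partialFourier {f : ℝ × ℝ → ℂ} (hf : Integrable f) :
    AEStronglyMeasurable (fun p : ℝ × ℝ => partialFourier f p.1 p.2) := by
  have h1 : AEStronglyMeasurable (fun x : (ℝ × ℝ) × ℝ => f (x.2, x.1.2)) := by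
    have hq : Measure.QuasiMeasurePreserving (fun x : (ℝ × ℝ) × ℝ => (x.2, x.1.2)) := 
      (Measure.measurePreserving_swap (μ := (volume : Measure ℝ))
        (ν := (volume : Measure ℝ))).quasiMeasurePreserving.comp
        (Measure.quasiMeasurePreserving_snd.comp
          (measurePreserving_prodAssoc (volume : Measure ℝ) (volume : Measure ℝ)
            (volume : Measure ℝ)).quasiMeasurePreserving)
    exact hf.aestronglyMeasurable.comp_quasiMeasurePreserving hq
  have h2 : Continuous fun x : (ℝ × ℝ) × ℝ =>
      Complex.exp (-Complex.I * (x.1.1 * x.2 : ℝ)) := by fun_prop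
  exact (h1.mul h2.aestronglyMeasurable).integral_prod_right'

end KappaMinkowski

/-! ### Integral operators and their Hilbert-Schmidt norm -/

/-- Distinct vectors of an orthonormal family have distance `√2`, so that the balls of radius `1/2`
around them are disjoint. -/
theorem Orthonormal.countable_of_separableSpace {E ι : Type*} [NormedAddCommGroup E]
    [InnerProductSpace ℂ E] [TopologicalSpace.SeparableSpace E] {b : ι → E}
    (hb : Orthonormal ℂ b) : Countable ι := by
  have hdist : ∀ i j, i ≠ j → 1 < ‖b i - b j‖ := by
    intro i j hij
    have h := @norm_sub_sq ℂ _ _ _ _ (b i) (b j)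
    rw [hb.2 hij, hb.1, hb.1, map_zero] at h
    nlinarith [norm_nonneg (b i - b j)]
  refine Pairwise.countable_of_isOpen_disjoint (s := fun i => Metric.ball (b i) (1 / 2)) ?_
    (fun _ => Metric.isOpen_ball) (fun i => ⟨b i, Metric.mem_ball_self (by norm_num)⟩)
  intro i j hij
  refine Metric.ball_disjoint_ball ?_
  rw [dist_eq_norm]
  linarith [hdist i j hij]

namespace KappaMinkowski

theorem memLp_two_of_lintegral_lt_top {k : ℝ → ℂ} (hk : AEStronglyMeasurable k)
    (h : ∫⁻ s, ‖k s‖ₑ ^ 2 < ⊤) : MemLp k 2 := by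
  refine ⟨hk, ?_⟩
  rw [eLpNorm_lt_top_iff_lintegral_rpow_enorm_lt_top (by norm_num) (by norm_num)]
  simpa using h

/-- The Hilbert-Schmidt norm of an integral operator is the `L²` norm of its kernel. For a countable
orthonormal basis `b` and almost every `s`, the numbers `A (b i) s` are the coefficients of `K s`
(up to complex conjugation), so that Parseval's identity applies for each `s`. -/
theorem hsNormSq_eq_lintegral_kernel (A : L2R →L[ℂ] L2R) {K : ℝ → ℝ → ℂ}
    (hK : StronglyMeasurable fun p : ℝ × ℝ => K p.1 p.2)
    (hfin : ∫⁻ s, ∫⁻ s', ‖K s s'‖ₑ ^ 2 < ⊤)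
    (hA : ∀ ξ : L2R, ∀ᵐ s, A ξ s = ∫ s', K s s' * ξ s') :
    hsNormSq A = ∫⁻ s, ∫⁻ s', ‖K s s'‖ₑ ^ 2 := by
  obtain ⟨w, b, -⟩ := exists_hilbertBasis ℂ L2R
  have : Fact ((2 : ℝ≥0∞) ≠ ⊤) := ⟨ENNReal.ofNat_ne_top⟩
  have hw : Countable w := b.orthonormal.countable_of_separableSpace
  rw [hsNormSq_eq b]
  simp_rw [← lintegral_enorm_sq_Lp]
  have hmeas : Measurable fun s => ∫⁻ s', ‖K s s'‖ₑ ^ 2 :=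
    (hK.enorm.pow_const 2).lintegral_prod_right'
  have hae : ∀ᵐ s, ∫⁻ s', ‖K s s'‖ₑ ^ 2 < ⊤ := ae_lt_top hmeas hfin.ne
  rw [← lintegral_tsum fun i => ((Lp.aestronglyMeasurable (A (b i))).enorm.pow_const 2)]
  have hAb : ∀ᵐ s, ∀ i, A (b i) s = ∫ s', K s s' * b i s' := ae_all_iff.2 fun i => hA (b i)
  refine lintegral_congr_ae ?_
  filter_upwards [hae, hAb] with s hs hsA
  have hKs : AEStronglyMeasurable (fun s' => starRingEnd ℂ (K s s')) :=
    (Complex.continuous_conj.comp_stronglyMeasurable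
      (hK.comp_measurable measurable_prodMk_left)).aestronglyMeasurable
  have hm : MemLp (fun s' => starRingEnd ℂ (K s s')) 2 :=
    memLp_two_of_lintegral_lt_top hKs (by simpa only [RCLike.enorm_conj] using hs)
  set k : L2R := hm.toLp _ with hk
  have hinner : ∀ i, A (b i) s = ⟪k, b i⟫_ℂ := by
    intro i
    rw [hsA, L2R_inner_def]
    refine integral_congr_ae ?_
    filter_upwards [hm.coeFn_toLp] with s' hs'
    rw [hk, hs', Complex.conj_conj]
  have e : ∀ i, ‖A (b i) s‖ₑ ^ 2 = ‖⟪b i, k⟫_ℂ‖ₑ ^ 2 := by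
    intro i
    rw [hinner, ← inner_conj_symm, RCLike.enorm_conj]
  simp_rw [e]
  rw [parseval_enorm, ← lintegral_enorm_sq_Lp]
  refine lintegral_congr_ae ?_
  filter_upwards [hm.coeFn_toLp] with s' hs'
  rw [hk, hs', RCLike.enorm_conj]

/-! ### The quantisation as an integral operator -/

theorem continuous_weyl_apply (ξ : L2R) : Continuous fun q : ℝ × ℝ => weyl q.1 q.2 ξ := by
  have h1 := continuous_expInt_one
  have h2 : Continuous fun q : ℝ × ℝ => (q.1, q.2 * expInt q.1 1) := by fun_prop
  simp only [weyl_eq_phaseShift]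
  exact (continuous_phaseShift ξ).comp h2

theorem norm_weyl_apply (α β : ℝ) (ξ : L2R) : ‖weyl α β ξ‖ = ‖ξ‖ := by
  rw [weyl_eq_phaseShift]
  exact (phaseShift α (β * expInt α 1)).norm_map ξ

theorem integrable_smul_weyl {g : ℝ × ℝ → ℂ} (hg : Integrable g) (ξ : L2R) :
    Integrable fun q : ℝ × ℝ => g q • weyl q.1 q.2 ξ := by
  refine (hg.norm.mul_const ‖ξ‖).mono'
    (hg.aestronglyMeasurable.smul (continuous_weyl_apply ξ).aestronglyMeasurable)
    (Filter.Eventually.of_forall fun q => ?_)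
  rw [norm_smul, norm_weyl_apply]

/-- The operator `(2π)⁻¹ ∫ g(α,β) exp (i (α T + β R)) dα dβ` for an integrable function `g`. -/
noncomputable def weylIntegral {g : ℝ × ℝ → ℂ} (hg : Integrable g) : L2R →L[ℂ] L2R :=
  LinearMap.mkContinuous
    { toFun := fun ξ => (2 * Real.pi : ℂ)⁻¹ • ∫ q : ℝ × ℝ, g q • weyl q.1 q.2 ξ
      map_add' := fun ξ η => by
        simp only [map_add, smul_add]
        rw [integral_add (integrable_smul_weyl hg ξ) (integrable_smul_weyl hg η), smul_add]
      map_smul' := fun c ξ => by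
        simp only [map_smul, RingHom.id_apply, smul_comm _ c]
        rw [integral_smul, smul_comm] }
    (‖(2 * Real.pi : ℂ)⁻¹‖ * ∫ q, ‖g q‖) fun ξ => by
      simp only [LinearMap.coe_mk, AddHom.coe_mk, norm_smul, mul_assoc]
      refine mul_le_mul_of_nonneg_left ?_ (norm_nonneg _)
      refine (norm_integral_le_integral_norm _).trans_eq ?_
      simp only [norm_smul, norm_weyl_apply]
      rw [integral_mul_const]

theorem weylIntegral_apply {g : ℝ × ℝ → ℂ} (hg : Integrable g) (ξ : L2R) :
    weylIntegral hg ξ = (2 * Real.pi : ℂ)⁻¹ • ∫ q : ℝ × ℝ, g q • weyl q.1 q.2 ξ := rfl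

/-- The value at `s` of `g(α,β) exp (i (α T + β R)) ξ`, as a function of `(α,β)` and `s`. -/
noncomputable def weylIntegrand (g : ℝ × ℝ → ℂ) (ξ : ℝ → ℂ) (q : ℝ × ℝ) (s : ℝ) : ℂ :=
  g q * (radialPhase (q.2 * expInt q.1 1) s * ξ (s + q.1))

theorem coeFn_smul_weyl (g : ℝ × ℝ → ℂ) (ξ : L2R) (q : ℝ × ℝ) :
    (g q • weyl q.1 q.2 ξ : L2R) =ᵐ[volume] weylIntegrand g ξ q := by
  rw [weyl_eq_phaseShift]
  filter_upwards [Lp.coeFn_smul (g q) ((phaseShift q.1 (q.2 * expInt q.1 1)) ξ),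
    coeFn_phaseShift q.1 (q.2 * expInt q.1 1) ξ] with s h1 h2
  rw [weylIntegrand, ← h2]
  exact h1

/-- Absolute integrability, jointly in `(α,β)` and `s`, against a square integrable `φ`; the bound is
`2 |φ(s) ξ(s + α)| ≤ |φ(s)|² + |ξ(s + α)|²`. -/
theorem integrable_mul_weylIntegrand {g : ℝ × ℝ → ℂ} (hg : Integrable g) (hgc : Continuous g)
    (ξ : L2R) {φ : ℝ → ℂ} (hφ : MemLp φ 2) :
    Integrable (fun p : (ℝ × ℝ) × ℝ => φ p.2 * weylIntegrand g ξ p.1 p.2)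
      ((volume : Measure (ℝ × ℝ)).prod (volume : Measure ℝ)) := by
  have h1 : Integrable (fun p : (ℝ × ℝ) × ℝ => ‖g p.1‖ * ‖φ p.2‖ ^ 2)
      ((volume : Measure (ℝ × ℝ)).prod (volume : Measure ℝ)) :=
    hg.norm.mul_prod ((memLp_two_iff_integrable_sq_norm hφ.1).1 hφ)
  have h2 : Integrable (fun p : (ℝ × ℝ) × ℝ => ‖g p.1‖ * ‖ξ p.2‖ ^ 2)
      ((volume : Measure (ℝ × ℝ)).prod (volume : Measure ℝ)) :=
    hg.norm.mul_prod ((memLp_two_iff_integrable_sq_norm (Lp.aestronglyMeasurable ξ)).1 (Lp.memLp ξ))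
  have hmp : MeasurePreserving (fun p : (ℝ × ℝ) × ℝ => (p.1, p.2 + p.1.1))
      ((volume : Measure (ℝ × ℝ)).prod (volume : Measure ℝ))
      ((volume : Measure (ℝ × ℝ)).prod (volume : Measure ℝ)) :=
    (MeasurePreserving.id _).skew_product (g := fun (q : ℝ × ℝ) s => s + q.1)
      (by unfold Function.uncurry; fun_prop)
      (Filter.Eventually.of_forall fun q => (measurePreserving_add_right volume q.1).map_eq)
  have h3 := hmp.integrable_comp_of_integrable h2
  refine (h1.add h3).mono' ?_ (Filter.Eventually.of_forall fun p => ?_)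
  · have c1 : Continuous fun p : (ℝ × ℝ) × ℝ => radialPhase (p.1.2 * expInt p.1.1 1) p.2 := by
      have := continuous_expInt_one
      exact continuous_radialPhase.comp
        (by fun_prop : Continuous fun p : (ℝ × ℝ) × ℝ => (p.1.2 * expInt p.1.1 1, p.2))
    have c2 : StronglyMeasurable fun p : (ℝ × ℝ) × ℝ => ξ (p.2 + p.1.1) :=
      (Lp.stronglyMeasurable ξ).comp_measurable (by fun_prop)
    have c3 : AEStronglyMeasurable (fun p : (ℝ × ℝ) × ℝ => φ p.2)
      ((volume : Measure (ℝ × ℝ)).prod (volume : Measure ℝ)) := hφ.1.comp_snd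
    exact c3.mul ((hgc.comp continuous_fst).aestronglyMeasurable.mul
      (c1.aestronglyMeasurable.mul c2.aestronglyMeasurable))
  · simp only [weylIntegrand, norm_mul, norm_radialPhase, one_mul, Pi.add_apply,
      Function.comp_apply]
    nlinarith [norm_nonneg (g p.1), sq_nonneg (‖φ p.2‖ - ‖ξ (p.2 + p.1.1)‖),
      mul_nonneg (norm_nonneg (g p.1)) (sq_nonneg (‖φ p.2‖ - ‖ξ (p.2 + p.1.1)‖)),
      mul_nonneg (norm_nonneg (g p.1)) (mul_nonneg (norm_nonneg (φ p.2))
        (norm_nonneg (ξ (p.2 + p.1.1))))]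

/-- The vector-valued integral `∫ g(α,β) exp (i (α T + β R)) ξ` may be evaluated pointwise. -/
theorem integral_smul_weyl_ae_eq {g : ℝ × ℝ → ℂ} (hg : Integrable g) (hgc : Continuous g)
    (ξ : L2R) :
    (∫ q : ℝ × ℝ, g q • weyl q.1 q.2 ξ : L2R) =ᵐ[volume]
      fun s => ∫ q : ℝ × ℝ, weylIntegrand g ξ q s := by
  set Y : L2R := ∫ q : ℝ × ℝ, g q • weyl q.1 q.2 ξ with hY
  have hloc : LocallyIntegrable (fun s => ∫ q : ℝ × ℝ, weylIntegrand g ξ q s) := by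
    rw [MeasureTheory.locallyIntegrable_iff]
    intro K hK
    have hm : MemLp (K.indicator fun _ => (1 : ℂ)) 2 :=
      memLp_indicator_const 2 hK.measurableSet 1 (Or.inr hK.measure_lt_top.ne)
    have h := (integrable_mul_weylIntegrand hg hgc ξ hm).integral_prod_right
    rw [← integrable_indicator_iff hK.measurableSet]
    refine h.congr (Filter.Eventually.of_forall fun s => ?_)
    by_cases hs : s ∈ K <;> simp [hs]
  refine ae_eq_of_integral_contDiff_smul_eq ((Lp.memLp Y).locallyIntegrable (by norm_num)) hloc
    fun φ hφ hc => ?_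
  have hc' : HasCompactSupport fun s => (φ s : ℂ) := hc.comp_left Complex.ofReal_zero
  have hφ0 := hφ.continuous
  have hm : MemLp (fun s => (φ s : ℂ)) 2 volume := memLp_of_test (by fun_prop) hc'
  have hint := integrable_mul_weylIntegrand hg hgc ξ hm
  have hpair : ∀ η : L2R, ⟪hm.toLp _, η⟫_ℂ = ∫ s, (φ s : ℂ) * η s := by
    intro η
    rw [L2R_inner_def]
    refine integral_congr_ae ?_
    filter_upwards [hm.coeFn_toLp] with s hs
    rw [hs, Complex.conj_ofReal]
  calc ∫ s, φ s • Y s = ∫ s, (φ s : ℂ) * Y s := by simp only [Complex.real_smul]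
    _ = ∫ q : ℝ × ℝ, ⟪hm.toLp _, g q • weyl q.1 q.2 ξ⟫_ℂ := by
      rw [← hpair, hY, integral_inner (integrable_smul_weyl hg ξ)]
    _ = ∫ q : ℝ × ℝ, ∫ s, (φ s : ℂ) * weylIntegrand g ξ q s := by
      refine integral_congr_ae (Filter.Eventually.of_forall fun q => ?_)
      simp only
      rw [hpair]
      refine integral_congr_ae ?_
      filter_upwards [coeFn_smul_weyl g ξ q] with s hs
      rw [hs]
    _ = ∫ s, ∫ q : ℝ × ℝ, (φ s : ℂ) * weylIntegrand g ξ q s := integral_integral_swap hint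
    _ = ∫ s, φ s • ∫ q : ℝ × ℝ, weylIntegrand g ξ q s := by
      simp only [Complex.real_smul, integral_const_mul]

theorem memLp_gaussian : MemLp (fun s : ℝ => (Real.exp (-s ^ 2) : ℂ)) 2 volume := by
  refine memLp_two_of_lintegral_lt_top (by fun_prop) ?_
  have h := (integrable_exp_neg_mul_sq (b := 2) (by norm_num)).lintegral_lt_top
  refine (lintegral_mono fun s => ?_).trans_lt h
  rw [← ofReal_norm, ← ENNReal.ofReal_pow (norm_nonneg _), Complex.norm_real,
    Real.norm_of_nonneg (Real.exp_pos _).le, ← Real.exp_nat_mul]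
  refine ENNReal.ofReal_le_ofReal (Real.exp_le_exp.2 ?_)
  push_cast
  linarith

theorem ae_integrable_weylIntegrand {g : ℝ × ℝ → ℂ} (hg : Integrable g) (hgc : Continuous g)
    (ξ : L2R) : ∀ᵐ s, Integrable fun q : ℝ × ℝ => weylIntegrand g ξ q s := by
  -- A nowhere vanishing square integrable function may be divided out.
  have h := (integrable_mul_weylIntegrand hg hgc ξ memLp_gaussian).prod_left_ae
  filter_upwards [h] with s hs
  refine (integrable_const_mul_iff (IsUnit.mk0 _ ?_) _).1 hs
  exact_mod_cast (Real.exp_pos _).ne'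

/-- The integral kernel of the operator `(2π)⁻¹ ∫ g(α,β) exp (i (α T + β R)) dα dβ`. -/
noncomputable def weylKernel (g : ℝ × ℝ → ℂ) (s s' : ℝ) : ℂ :=
  (2 * Real.pi : ℂ)⁻¹ * partialFourierInv g (s' - s) (expInt (s' - s) 1 * Real.exp (-s))

/-- The operator `weylIntegral hg` is an integral operator: integrate over `β` first and substitute
`s' = s + α`. -/
theorem weylIntegral_ae_eq {g : ℝ × ℝ → ℂ} (hg : Integrable g) (hgc : Continuous g) (ξ : L2R) :
    ∀ᵐ s, weylIntegral hg ξ s = ∫ s', weylKernel g s s' * ξ s' := by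
  rw [weylIntegral_apply]
  filter_upwards [Lp.coeFn_smul (2 * Real.pi : ℂ)⁻¹ (∫ q : ℝ × ℝ, g q • weyl q.1 q.2 ξ),
    integral_smul_weyl_ae_eq hg hgc ξ, ae_integrable_weylIntegrand hg hgc ξ] with s h1 h2 h3
  rw [h1, Pi.smul_apply, h2, smul_eq_mul, Measure.volume_eq_prod, integral_prod _ h3,
    ← integral_add_left_eq_self (fun s' => weylKernel g s s' * ξ s') s, ← integral_const_mul]
  refine integral_congr_ae (Filter.Eventually.of_forall fun a => ?_)
  simp only [weylKernel, weylIntegrand, partialFourierInv, add_sub_cancel_left]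
  rw [mul_assoc, ← integral_mul_const]
  congr 1
  refine integral_congr_ae (Filter.Eventually.of_forall fun b => ?_)
  simp only [radialPhase, mul_assoc]
  rw [mul_comm Complex.I]

theorem stronglyMeasurable_weylKernel {g : ℝ × ℝ → ℂ} (hg : Continuous g) :
    StronglyMeasurable fun p : ℝ × ℝ => weylKernel g p.1 p.2 := by
  have h := continuous_expInt_one
  have hm : Continuous fun p : ℝ × ℝ =>
      (p.2 - p.1, expInt (p.2 - p.1) 1 * Real.exp (-p.1)) := by fun_prop
  exact ((stronglyMeasurable_partialFourierInv hg).comp_measurable hm.measurable).const_mul _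

/-- The substitution `r = c e⁻ˢ`, under which `ds` becomes `dr / r` on `(0, ∞)`. -/
theorem lintegral_comp_mul_exp_neg {c : ℝ} (hc : 0 < c) (F : ℝ → ℝ≥0∞) :
    ∫⁻ s, F (c * Real.exp (-s)) = ∫⁻ r in Set.Ioi 0, ENNReal.ofReal r⁻¹ * F r := by
  have h := lintegral_image_eq_lintegral_abs_deriv_mul (s := Set.univ)
    MeasurableSet.univ (f := fun s : ℝ => c * Real.exp (-s))
    (f' := fun s => -(c * Real.exp (-s)))
    (fun s _ => by simpa using (hasDerivAt_id s).neg.exp.const_mul c)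
    (fun x _ y _ hxy => by simpa [hc.ne'] using hxy) (fun r => ENNReal.ofReal r⁻¹ * F r)
  have himg : (fun s : ℝ => c * Real.exp (-s)) '' Set.univ = Set.Ioi 0 := by
    ext r
    constructor
    · rintro ⟨s, -, rfl⟩
      exact mul_pos hc (Real.exp_pos _)
    · intro (hr : 0 < r)
      refine ⟨-Real.log (r / c), trivial, ?_⟩
      simp only [neg_neg]
      rw [Real.exp_log (div_pos hr hc)]
      field_simp
  rw [himg, Measure.restrict_univ] at h
  rw [h]
  refine lintegral_congr fun s => ?_
  have hpos : 0 < c * Real.exp (-s) := mul_pos hc (Real.exp_pos _)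
  rw [abs_neg, abs_of_pos hpos, ← mul_assoc, ← ENNReal.ofReal_mul hpos.le,
    mul_inv_cancel₀ hpos.ne', ENNReal.ofReal_one, one_mul]

/-! ### The norm of the kernel -/

open scoped Real

/-- The density of the measure `dr / r` on `(0, ∞)`. -/
noncomputable def invWeight (r : ℝ) : ℝ≥0∞ :=
  (Set.Ioi 0).indicator (fun r => ENNReal.ofReal r⁻¹) r

theorem measurable_invWeight : Measurable invWeight :=
  Measurable.indicator (by fun_prop) measurableSet_Ioi

theorem invWeight_ne_top (r : ℝ) : invWeight r ≠ ⊤ := by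
  unfold invWeight
  by_cases h : r ∈ Set.Ioi (0 : ℝ) <;> simp [h]

/-- The `L²` norm of the kernel, after the substitution `r = κ(α) e⁻ˢ` for each fixed `α`. The factor
`κ(α) = expInt α 1` disappears because `dr / r` is invariant under dilations. -/
theorem lintegral_enorm_sq_weylKernel {g : ℝ × ℝ → ℂ} (hg : Continuous g) :
    ∫⁻ s, ∫⁻ s', ‖weylKernel g s s'‖ₑ ^ 2
      = ENNReal.ofReal ((2 * π)⁻¹ ^ 2) *
        ∫⁻ a, ∫⁻ r, invWeight r * ‖partialFourierInv g a r‖ₑ ^ 2 := by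
  have hM : StronglyMeasurable fun p : ℝ × ℝ => weylKernel g p.1 (p.1 + p.2) :=
    (stronglyMeasurable_weylKernel hg).comp_measurable
      (by fun_prop : Measurable fun p : ℝ × ℝ => (p.1, p.1 + p.2))
  have hconst : ‖(2 * π : ℂ)⁻¹‖ₑ ^ 2 = ENNReal.ofReal ((2 * π)⁻¹ ^ 2) := by
    rw [← ofReal_norm, ← ENNReal.ofReal_pow (norm_nonneg _), norm_inv, norm_mul,
      Complex.norm_real, Real.norm_of_nonneg Real.pi_pos.le]
    simp
  calc ∫⁻ s, ∫⁻ s', ‖weylKernel g s s'‖ₑ ^ 2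
      = ∫⁻ s, ∫⁻ a, ‖weylKernel g s (s + a)‖ₑ ^ 2 := by
        refine lintegral_congr fun s => ?_
        rw [lintegral_add_left_eq_self (fun s' => ‖weylKernel g s s'‖ₑ ^ 2) s]
    _ = ∫⁻ a, ∫⁻ s, ‖weylKernel g s (s + a)‖ₑ ^ 2 := by
        exact lintegral_lintegral_swap (hM.enorm.pow_const 2).aemeasurable
    _ = ∫⁻ a, ENNReal.ofReal ((2 * π)⁻¹ ^ 2) *
          ∫⁻ r, invWeight r * ‖partialFourierInv g a r‖ₑ ^ 2 := by
        refine lintegral_congr fun a => ?_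
        simp only [weylKernel, add_sub_cancel_left, enorm_mul, mul_pow, hconst]
        rw [lintegral_const_mul' _ _ ENNReal.ofReal_ne_top,
          lintegral_comp_mul_exp_neg (expInt_one_pos a)
            (fun r => ‖partialFourierInv g a r‖ₑ ^ 2),
          ← lintegral_indicator measurableSet_Ioi]
        congr 2 with r
        unfold invWeight
        by_cases h : r ∈ Set.Ioi (0 : ℝ) <;> simp [h]
    _ = _ := lintegral_const_mul' _ _ ENNReal.ofReal_ne_top

/-- Plancherel's identity in the first variable, for almost every value of the second one. -/
theorem lintegral_partialFourierInv_fourier2 {f : ℝ × ℝ → ℂ} (hf : Integrable f)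
    (hf' : Integrable (fourier2 f))
    (hfin : ∫⁻ r, ∫⁻ t, invWeight r * ‖f (t, r)‖ₑ ^ 2 < ⊤) :
    ∫⁻ a, ∫⁻ r, invWeight r * ‖partialFourierInv (fourier2 f) a r‖ₑ ^ 2
      = ENNReal.ofReal (2 * π) * ∫⁻ r, ∫⁻ t, invWeight r * ‖f (t, r)‖ₑ ^ 2 := by
  have hw : AEMeasurable (fun p : ℝ × ℝ => invWeight p.2 * ‖partialFourier f p.1 p.2‖ₑ ^ 2)
      ((volume : Measure ℝ).prod (volume : Measure ℝ)) :=
    (measurable_invWeight.comp measurable_snd).aemeasurable.mul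
      ((aestronglyMeasurable_partialFourier hf).enorm.pow_const 2)
  calc ∫⁻ a, ∫⁻ r, invWeight r * ‖partialFourierInv (fourier2 f) a r‖ₑ ^ 2
      = ∫⁻ a, ∫⁻ r, invWeight r * ‖partialFourier f a r‖ₑ ^ 2 := by
        refine lintegral_congr_ae ?_
        filter_upwards [partialFourierInv_fourier2_ae_eq hf hf'] with a ha
        refine lintegral_congr_ae ?_
        filter_upwards [ha] with r hr
        rw [hr]
    _ = ∫⁻ r, ∫⁻ a, invWeight r * ‖partialFourier f a r‖ₑ ^ 2 :=
        lintegral_lintegral_swap hw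
    _ = ∫⁻ r, ENNReal.ofReal (2 * π) * ∫⁻ t, invWeight r * ‖f (t, r)‖ₑ ^ 2 := by
        have hmeas : AEMeasurable fun p : ℝ × ℝ => invWeight p.1 * ‖f (p.2, p.1)‖ₑ ^ 2 :=
          (measurable_invWeight.comp measurable_fst).aemeasurable.mul
            (hf.swap.aestronglyMeasurable.enorm.pow_const 2)
        have hae := ae_lt_top' hmeas.lintegral_prod_right' hfin.ne
        refine lintegral_congr_ae ?_
        filter_upwards [hae, hf.prod_left_ae] with r hr hfr
        rw [lintegral_const_mul' _ _ (invWeight_ne_top r),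
          lintegral_const_mul' _ _ (invWeight_ne_top r)]
        by_cases h0 : invWeight r = 0
        · simp [h0]
        have hlt : ∫⁻ t, ‖f (t, r)‖ₑ ^ 2 < ⊤ := by
          rw [lintegral_const_mul' _ _ (invWeight_ne_top r)] at hr
          exact ENNReal.lt_top_of_mul_ne_top_right hr.ne h0
        have hP := lintegral_enorm_sq_fourier_integral hfr
          (memLp_two_of_lintegral_lt_top hfr.aestronglyMeasurable hlt)
        rw [mul_left_comm, ← hP]
        rfl
    _ = _ := lintegral_const_mul' _ _ ENNReal.ofReal_ne_top

theorem lintegral_invWeight_mul_enorm_sq {f : ℝ × ℝ → ℂ} (hf : Integrable f) :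
    ∫⁻ r, ∫⁻ t, invWeight r * ‖f (t, r)‖ₑ ^ 2
      = ∫⁻ p : ℝ × ℝ in {p : ℝ × ℝ | 0 < p.2}, ENNReal.ofReal (‖f p‖ ^ 2 / p.2) := by
  have hset : MeasurableSet {p : ℝ × ℝ | 0 < p.2} :=
    measurableSet_lt measurable_const measurable_snd
  have hmeas : AEMeasurable fun p : ℝ × ℝ => invWeight p.2 * ‖f p‖ₑ ^ 2 :=
    (measurable_invWeight.comp measurable_snd).aemeasurable.mul
      (hf.aestronglyMeasurable.enorm.pow_const 2)
  rw [← lintegral_indicator hset, Measure.volume_eq_prod]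
  rw [← lintegral_prod_symm (fun p : ℝ × ℝ => invWeight p.2 * ‖f p‖ₑ ^ 2) hmeas]
  refine lintegral_congr fun p => ?_
  unfold invWeight
  by_cases h : 0 < p.2
  · rw [Set.indicator_of_mem (show p.2 ∈ Set.Ioi 0 from h),
      Set.indicator_of_mem (show p ∈ {p : ℝ × ℝ | 0 < p.2} from h), ← ofReal_norm,
      ← ENNReal.ofReal_pow (norm_nonneg _), ← ENNReal.ofReal_mul (inv_nonneg.2 h.le),
      div_eq_inv_mul]
  · rw [Set.indicator_of_notMem (show p.2 ∉ Set.Ioi 0 from h),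
      Set.indicator_of_notMem (show p ∉ {p : ℝ × ℝ | 0 < p.2} from h), zero_mul]

end KappaMinkowski

theorem mainTheorem6 (f : ℝ × ℝ → ℂ) (hf : KappaMinkowski.IsSymbol f)
    (hfin : MeasureTheory.IntegrableOn (fun p : ℝ × ℝ => ‖f p‖ ^ 2 / p.2)
      {p : ℝ × ℝ | 0 < p.2}) :
    ∃ A : KappaMinkowski.L2R →L[ℂ] KappaMinkowski.L2R,
      KappaMinkowski.IsQuantisation f A ∧
      KappaMinkowski.IsHilbertSchmidt A ∧
      KappaMinkowski.hsNorm A =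
        Real.sqrt ((2 * Real.pi)⁻¹ *
          ∫ p : ℝ × ℝ in {p : ℝ × ℝ | 0 < p.2}, ‖f p‖ ^ 2 / p.2) := by
  open KappaMinkowski in
  have hg : Integrable (fourier2 f) := integrable_fourier2 hf
  have hgc : Continuous (fourier2 f) := continuous_fourier2 hf.1
  have hset : MeasurableSet {p : ℝ × ℝ | 0 < p.2} :=
    measurableSet_lt measurable_const measurable_snd
  have hnonneg : 0 ≤ᵐ[volume.restrict {p : ℝ × ℝ | 0 < p.2}]
      fun p : ℝ × ℝ => ‖f p‖ ^ 2 / p.2 := by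
    filter_upwards [ae_restrict_mem hset] with p hp
    exact div_nonneg (sq_nonneg _) (le_of_lt hp)
  set I := ∫ p : ℝ × ℝ in {p : ℝ × ℝ | 0 < p.2}, ‖f p‖ ^ 2 / p.2 with hI
  have hI0 : 0 ≤ I := integral_nonneg_of_ae hnonneg
  have hlin : ∫⁻ r, ∫⁻ t, invWeight r * ‖f (t, r)‖ₑ ^ 2 = ENNReal.ofReal I := by
    rw [lintegral_invWeight_mul_enorm_sq hf.1, hI, ofReal_integral_eq_lintegral_ofReal hfin hnonneg]
  have hpos : (0 : ℝ) < 2 * Real.pi := by positivity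
  have hkernel : ∫⁻ s, ∫⁻ s', ‖weylKernel (fourier2 f) s s'‖ₑ ^ 2
      = ENNReal.ofReal ((2 * Real.pi)⁻¹ * I) := by
    rw [lintegral_enorm_sq_weylKernel hgc, lintegral_partialFourierInv_fourier2 hf.1 hg
      (by rw [hlin]; exact ENNReal.ofReal_lt_top), hlin, ← ENNReal.ofReal_mul hpos.le,
      ← ENNReal.ofReal_mul (by positivity)]
    congr 1
    field_simp
  have hHS : hsNormSq (weylIntegral hg) = ENNReal.ofReal ((2 * Real.pi)⁻¹ * I) := by
    rw [← hkernel]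
    exact hsNormSq_eq_lintegral_kernel _ (stronglyMeasurable_weylKernel hgc)
      (by rw [hkernel]; exact ENNReal.ofReal_lt_top) (weylIntegral_ae_eq hg hgc)
  refine ⟨weylIntegral hg, fun ξ => ⟨integrable_smul_weyl hg ξ, weylIntegral_apply hg ξ⟩, ?_, ?_⟩
  · rw [IsHilbertSchmidt, hHS]
    exact ENNReal.ofReal_lt_top
  · rw [hsNorm, hHS, ENNReal.toReal_ofReal (by positivity)]
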